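/- **Theorem 1.2.** Let $\mathbb D$ be the open unit disk, let $\rho(z,w)=\left|\frac{z-w}{1-\bar z w}\right|$, and for $0<r<1$ let $D(z,r)=\{w\in\mathbb D:\rho(z,w)<r\}$. Let $\operatorname{Har}_+(\mathbb D)$ be the set of positive harmonic functions on $\mathbb D$. Let $N$ be the Nevanlinna class, i.e. the set of holomorphic $f$ on $\mathbb D$ for which there is $H\in\operatorname{Har}_+(\mathbb D)$ with $\log_+|f|\le H$ on $\mathbb D$. Let $\Lambda=\{\lambda_n\}_n$ be a nonempty (finite or infinite) sequence of distinct points of $\mathbb D$ with $\sum_n(1-|\lambda_n|)<\infty$. Put $b_\lambda(z)=\frac{\bar\lambda}{|\lambda|}\frac{\lambda-z}{1-\bar\lambda z}$ for $\lambda\neq 0$ and $b_0(z)=z$, let $B=\prod_n b_{\lambda_n}$ be the Blaschke product with zero set $\Lambda$, and let $B_n=B/b_{\lambda_n}=\prod_{k\ne n}b_{\lambda_k}$. Put $\rho(z,\Lambda)=\inf_n\rho(z,\lambda_n)$. For $H\in\operatorname{Har}_+(\mathbb D)$ let $\mathcal D_n^H=D(\lambda_n,e^{-H(\lambda_n)})$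 and let $\Omega_n^H$ be the interior of $$\mathbb D\setminus\bigcup_{k\neq n,\ \rho(\lambda_k,\lambda_n)\le 1/2}\mathcal D_k^H .$$ For a bounded open set $\Omega\subset\mathbb C$, $E\subset\partial\Omega$ and $z\in\Omega$, let $\omega(z,E,\Omega)$ be the harmonic measure of $E$ in $\Omega$ at $z$, i.e. the value at $z$ of the Perron solution of the Dirichlet problem in $\Omega$ with boundary values $\mathbf 1_E$. Then $(1-|\lambda_n|^2)|B'(\lambda_n)|=|B_n(\lambda_n)|$ for all $n$, and the following statements are equivalent: * (a) $\Lambda$ is interpolating for $N$, i.e. the trace space $N|\Lambda=\{(f(\lambda_n))_n: f\in N\}$ is stable under pointwise multiplication by bounded sequences; * (a$'$) there exists $H\in\operatorname{Har}_+(\mathbb D)$ such that $|B_n(\lambda_n)|\ge e^{-H(\lambda_n)}$ for all $n$; * (b) there exists $H\in\operatorname{Har}_+(\mathbb D)$ such that $|B(z)|\ge e^{-H(z)}\rho(z,\Lambda)$ for all $z\in\mathbb D$; * (c) there exists $H\in\operatorname{Har}_+(\mathbb D)$ such that $|B(z)|+(1-|z|^2)|B'(z)|\ge e^{-H(z)}$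 for all $z\in\mathbb D$; * (d) there exists $H\in\operatorname{Har}_+(\mathbb D)$ such that the disks $\mathcal D_n^H$ are pairwise disjoint and $\inf_n\omega(\lambda_n,\partial\mathbb D,\Omega_n^H)>0$. -/

import Mathlib

open scoped ComplexConjugate

noncomputable section

namespace NevInt

/-- The open unit disk. -/
abbrev disk : Set ℂ := Metric.ball (0 : ℂ) 1

/-- The pseudohyperbolic distance `ρ(z, w) = |(z - w) / (1 - z̄ w)|`. -/
def rho (z w : ℂ) : ℝ := ‖(z - w) / (1 - conj z * w)‖

/-- The open pseudohyperbolic disk `D(z, r) = {w ∈ 𝔻 : ρ(z, w) < r}`. -/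
def pDisk (z : ℂ) (r : ℝ) : Set ℂ := {w ∈ disk | rho z w < r}

/-- The cone `Har₊(𝔻)` of positive harmonic functions in the unit disk
(the values outside the disk are irrelevant). -/
def HarPos (H : ℂ → ℝ) : Prop :=
  InnerProductSpace.HarmonicOnNhd H disk ∧ ∀ z ∈ disk, 0 < H z

/-- The Nevanlinna class: holomorphic functions on the disk such that `log⁺ |f|` has a positive
harmonic majorant. -/
def Nevanlinna (f : ℂ → ℂ) : Prop :=
  DifferentiableOn ℂ f disk ∧ ∃ H, HarPos H ∧ ∀ z ∈ disk, Real.posLog ‖f z‖ ≤ H z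

variable {ι : Type*}

/-- The trace space `N|Λ = {(f(lamₙ))ₙ : f ∈ N}`. -/
def traceSpace (lam : ι → ℂ) : Set (ι → ℂ) :=
  {w | ∃ f, Nevanlinna f ∧ ∀ n, f (lam n) = w n}

/-- A sequence space is ideal if it is stable under pointwise multiplication by bounded
sequences. -/
def IsIdealSpace (S : Set (ι → ℂ)) : Prop :=
  ∀ w ∈ S, ∀ v : ι → ℂ, (∃ C : ℝ, ∀ n, ‖v n‖ ≤ C) → (fun n => v n * w n) ∈ S

/-- `Λ` is interpolating for the Nevanlinna class: the trace space is ideal. -/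
def IsInterpolating (lam : ι → ℂ) : Prop := IsIdealSpace (traceSpace lam)

/-- A Blaschke sequence: points of the disk with `∑ (1 - |lamₙ|) < ∞`. -/
def IsBlaschkeSeq (lam : ι → ℂ) : Prop :=
  (∀ n, lam n ∈ disk) ∧ Summable (fun n => 1 - ‖lam n‖)

/-- The elementary Blaschke factor `(ā / |a|) (a - z) / (1 - ā z)`, with the usual convention
that it is `z` for `a = 0`. -/
def blaschkeFactor (a z : ℂ) : ℂ :=
  if a = 0 then z else conj a / (‖a‖ : ℂ) * ((a - z) / (1 - conj a * z))

/-- The Blaschke product `B` with zeros `lamₙ`. -/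
def blaschke (lam : ι → ℂ) (z : ℂ) : ℂ := ∏' n, blaschkeFactor (lam n) z

/-- The Blaschke product `Bₙ = B / b_{lamₙ}` with the `n`-th factor removed. -/
def blaschkeDel (lam : ι → ℂ) (n : ι) (z : ℂ) : ℂ :=
  ∏' k : {k : ι // k ≠ n}, blaschkeFactor (lam k) z

/-- `ρ(z, Λ) = inf_n ρ(z, lamₙ)`. -/
def rhoSet (z : ℂ) (lam : ι → ℂ) : ℝ := ⨅ n, rho z (lam n)

/-- The disks `𝓓ₙᴴ = D(lamₙ, exp (-H(lamₙ)))`. -/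
def hDisk (lam : ι → ℂ) (H : ℂ → ℝ) (n : ι) : Set ℂ := pDisk (lam n) (Real.exp (-H (lam n)))

/-- The open set `Ωₙᴴ`: the disk minus the disks `𝓓ₖᴴ` with `k ≠ n` and `ρ(lamₖ, lamₙ) ≤ 1/2`.
As the `𝓓ₖᴴ` are open, the interior is taken in order to have an open set. -/
def hDomain (lam : ι → ℂ) (H : ℂ → ℝ) (n : ι) : Set ℂ :=
  interior (disk \ ⋃ k ∈ {k : ι | k ≠ n ∧ rho (lam k) (lam n) ≤ 1 / 2}, hDisk lam H k)

/-- Subharmonic (finite valued) functions on an open subset of the plane: upper semicontinuous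
functions with the sub-mean value property on all circles that bound a closed disk in `Ω`. -/
def SubharmonicOn (u : ℂ → ℝ) (Ω : Set ℂ) : Prop :=
  UpperSemicontinuousOn u Ω ∧
    ∀ c : ℂ, ∀ r : ℝ, 0 < r → Metric.closedBall c r ⊆ Ω →
      CircleIntegrable u c r ∧ u c ≤ Real.circleAverage u c r

/-- The Perron family of a bounded open set `Ω` for the boundary function `1_E`: subharmonic
functions `u` on `Ω` with `limsup_{z → ξ} u(z) ≤ 1_E(ξ)` for all `ξ ∈ ∂Ω`. -/
def PerronFamily (E Ω : Set ℂ) : Set (ℂ → ℝ) :=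
  {u | SubharmonicOn u Ω ∧ ∀ ξ ∈ frontier Ω, ∀ t : ℝ, E.indicator (fun _ => (1 : ℝ)) ξ < t →
    ∀ᶠ z in nhdsWithin ξ Ω, u z < t}

/-- The harmonic measure `ω(z, E, Ω)` of `E ⊆ ∂Ω` at the point `z` of the bounded open set `Ω`:
the value at `z` of the Perron solution of the Dirichlet problem with boundary values `1_E`.
Restricting the Perron family to finite valued functions does not change the supremum, since `u`
may be replaced by `max u 0`. -/
def harmonicMeasure (z : ℂ) (E Ω : Set ℂ) : ℝ :=
  sSup ((fun u : ℂ → ℝ => u z) '' PerronFamily E Ω)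

end NevInt

end

namespace NevInt

/-! Every condition is compared with (a'), read as a bound by `H (lam n)` for the sum over k ≠ n of
-log ρ(λ_n, λ_k). The errors are absorbed by one positive harmonic function, K = `blaschkePotential
lam`, which dominates the sum of 1 - ρ(z, λ_k)². Hence points with ρ ≥ d contribute at most K(z)/d
to the sum of -log ρ(z, λ_k), and at most 2K(z) points satisfy ρ ≤ 1/2. Harnack's inequality moves
the values of H between nearby points.

(a') gives (a) by an explicit series built from the B_n and kernels that peak at λ_n
(`exists_interpolating`). Conversely, a cut of the complete graph on Λ with weights -log ρ leaves
each vertex at least half of its weight across (`exists_cut`). Interpolating the indicators of the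
two sides bounds the weights across by a positive harmonic function, since the zeros of the
interpolating functions can be divided out.

For (b) and (c), if λ_n is nearest to z then ρ(λ_n, λ_k) ≤ 2ρ(z, λ_k), so the bound at λ_n passes to
B_n(z) (`exp_le_blaschkeDel_nearest`).

For (d), harmonic measure is compared with the Green potential of the nearby points by the maximum
principle. From (a'), 1 - potential/m competes in the Perron family. Conversely, let S be the
largest ratio of potential to H + K over a finite subset. The lower bound ε on harmonic measure
returns an estimate of S by (1 - ε/2)S plus a constant, so S is bounded independently of the subset
(`greenSum_erase_le`). -/

/-! ### Pseudohyperbolic distance and disk automorphisms -/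

theorem mem_disk {z : ℂ} : z ∈ disk ↔ ‖z‖ < 1 := by simp [disk]

theorem normSq_one_sub_conj_mul (z w : ℂ) :
    ‖1 - conj z * w‖ ^ 2 = ‖z - w‖ ^ 2 + (1 - ‖z‖ ^ 2) * (1 - ‖w‖ ^ 2) := by
  simp only [← Complex.normSq_eq_norm_sq, Complex.normSq_apply, Complex.sub_re, Complex.sub_im,
    Complex.mul_re, Complex.mul_im, Complex.conj_re, Complex.conj_im, Complex.one_re,
    Complex.one_im]
  ring

theorem one_sub_conj_mul_ne_zero {z w : ℂ} (hz : z ∈ disk) (hw : ‖w‖ ≤ 1) :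
    1 - conj z * w ≠ 0 := by
  rw [mem_disk] at hz
  intro h
  have h1 : ‖conj z * w‖ = 1 := by
    rw [← sub_eq_zero.1 h]; simp
  rw [norm_mul, Complex.norm_conj] at h1
  nlinarith [norm_nonneg z, norm_nonneg w]

theorem one_sub_norm_le_norm_one_sub_conj_mul {z w : ℂ} (hz : z ∈ disk) :
    1 - ‖w‖ ≤ ‖1 - conj z * w‖ := by
  rw [mem_disk] at hz
  have h := norm_sub_norm_le 1 (conj z * w)
  rw [norm_mul, Complex.norm_conj, norm_one] at h
  nlinarith [norm_nonneg z, norm_nonneg w]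

theorem rho_nonneg (z w : ℂ) : 0 ≤ rho z w := norm_nonneg _

theorem rho_self (z : ℂ) : rho z z = 0 := by simp [rho]

theorem rho_eq (z w : ℂ) : rho z w = ‖z - w‖ / ‖1 - conj z * w‖ := by rw [rho, norm_div]

theorem rho_comm (z w : ℂ) : rho z w = rho w z := by
  rw [rho_eq, rho_eq, norm_sub_rev, ← Complex.norm_conj (1 - conj z * w)]
  simp [mul_comm]

theorem rho_zero_right (z : ℂ) : rho z 0 = ‖z‖ := by simp [rho]

theorem one_sub_rho_sq {z w : ℂ} (hz : z ∈ disk) (hw : ‖w‖ ≤ 1) :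
    1 - rho z w ^ 2 = (1 - ‖z‖ ^ 2) * (1 - ‖w‖ ^ 2) / ‖1 - conj z * w‖ ^ 2 := by
  have h : ‖1 - conj z * w‖ ≠ 0 := norm_ne_zero_iff.2 (one_sub_conj_mul_ne_zero hz hw)
  rw [rho_eq, div_pow, eq_div_iff (pow_ne_zero 2 h), sub_mul, div_mul_cancel₀ _ (pow_ne_zero 2 h),
    normSq_one_sub_conj_mul]
  ring

theorem rho_lt_one {z w : ℂ} (hz : z ∈ disk) (hw : w ∈ disk) : rho z w < 1 := by
  have h : (0 : ℝ) < ‖1 - conj z * w‖ :=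
    norm_pos_iff.2 (one_sub_conj_mul_ne_zero hz (mem_disk.1 hw).le)
  have h1 := one_sub_rho_sq hz (mem_disk.1 hw).le
  rw [mem_disk] at hz hw
  have h2 : 0 < 1 - rho z w ^ 2 := by
    rw [h1]
    have := norm_nonneg z
    have := norm_nonneg w
    have a : 0 < 1 - ‖z‖ ^ 2 := by nlinarith
    have b : 0 < 1 - ‖w‖ ^ 2 := by nlinarith
    positivity
  nlinarith [rho_nonneg z w]

theorem rho_pos {z w : ℂ} (hz : z ∈ disk) (hw : w ∈ disk) (h : z ≠ w) : 0 < rho z w :=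
  norm_pos_iff.2 (div_ne_zero (sub_ne_zero.2 h) (one_sub_conj_mul_ne_zero hz (mem_disk.1 hw).le))

/-- The triangle inequality through the origin. In the formula for 1 - ρ² the denominator is at most
(1 + |z||w|)², the extremal case of opposite arguments. Möbius invariance then moves the middle
point, which gives `rho_triangle`. -/
theorem rho_le_add_norm {z w : ℂ} (hz : z ∈ disk) (hw : w ∈ disk) :
    rho z w ≤ ‖z‖ + ‖w‖ := by
  have h : (0 : ℝ) < ‖1 - conj z * w‖ :=
    norm_pos_iff.2 (one_sub_conj_mul_ne_zero hz (mem_disk.1 hw).le)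
  have h1 := one_sub_rho_sq hz (mem_disk.1 hw).le
  rw [mem_disk] at hz hw
  have hz0 := norm_nonneg z
  have hw0 := norm_nonneg w
  have h2 : ‖1 - conj z * w‖ ≤ 1 + ‖z‖ * ‖w‖ := by
    refine (norm_sub_le _ _).trans ?_
    simp
  have a : 0 < 1 - ‖z‖ ^ 2 := by nlinarith
  have b : 0 < 1 - ‖w‖ ^ 2 := by nlinarith
  have h3 : (1 - ‖z‖ ^ 2) * (1 - ‖w‖ ^ 2) / (1 + ‖z‖ * ‖w‖) ^ 2 ≤ 1 - rho z w ^ 2 := by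
    rw [h1]
    gcongr
  have h4 : 1 - (‖z‖ + ‖w‖) ^ 2 ≤ (1 - ‖z‖ ^ 2) * (1 - ‖w‖ ^ 2) / (1 + ‖z‖ * ‖w‖) ^ 2 := by
    have hp : 0 ≤ ‖z‖ * ‖w‖ := by positivity
    rw [le_div_iff₀ (by positivity)]
    nlinarith [mul_nonneg (sq_nonneg (‖z‖ + ‖w‖)) (by positivity : 0 ≤ 2 * (‖z‖ * ‖w‖) + (‖z‖ * ‖w‖)^2)]
  exact abs_le_of_sq_le_sq' (by linarith : rho z w ^ 2 ≤ (‖z‖ + ‖w‖) ^ 2) (by positivity) |>.2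

/-- The automorphism of the disk that maps `0` to `a`. -/
noncomputable def mobius (a z : ℂ) : ℂ := (z + a) / (1 + conj a * z)

theorem one_add_conj_mul_ne_zero {z w : ℂ} (hz : z ∈ disk) (hw : ‖w‖ ≤ 1) :
    1 + conj z * w ≠ 0 := by
  simpa using one_sub_conj_mul_ne_zero (w := -w) hz (by simpa using hw)

theorem neg_mem_disk {a : ℂ} (ha : a ∈ disk) : -a ∈ disk := by
  simpa [mem_disk] using ha

theorem norm_mobius (a z : ℂ) : ‖mobius a z‖ = rho (-a) z := by
  rw [mobius, rho, ← norm_neg]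
  congr 1
  rw [← neg_div]
  simp
  ring

theorem mobius_mem_disk {a z : ℂ} (ha : a ∈ disk) (hz : z ∈ disk) : mobius a z ∈ disk := by
  rw [mem_disk, norm_mobius]
  exact rho_lt_one (neg_mem_disk ha) hz

theorem mobius_mobius_neg {a z : ℂ} (ha : a ∈ disk) (hz : z ∈ disk) :
    mobius a (mobius (-a) z) = z := by
  have h1 := one_sub_conj_mul_ne_zero ha (mem_disk.1 hz).le
  have h2 := one_sub_conj_mul_ne_zero ha (mem_disk.1 ha).le
  have e1 : mobius (-a) z + a = (1 - conj a * a) * z / (1 - conj a * z) := by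
    simp only [mobius, map_neg, neg_mul, ← sub_eq_add_neg]
    rw [div_add' _ _ _ h1]
    congr 1
    ring
  have e2 : 1 + conj a * mobius (-a) z = (1 - conj a * a) / (1 - conj a * z) := by
    simp only [mobius, map_neg, neg_mul, ← sub_eq_add_neg]
    rw [mul_div_assoc', add_div' _ _ _ h1]
    congr 1
    ring
  rw [mobius, e1, e2, div_div_div_cancel_right₀ h1, mul_div_cancel_left₀ _ h2]

theorem rho_mobius {a z w : ℂ} (ha : a ∈ disk) (hz : z ∈ disk) (hw : w ∈ disk) :
    rho (mobius a z) (mobius a w) = rho z w := by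
  have h1 := one_add_conj_mul_ne_zero ha (mem_disk.1 hz).le
  have h2 := one_add_conj_mul_ne_zero ha (mem_disk.1 hw).le
  have h3 := one_sub_conj_mul_ne_zero ha (mem_disk.1 ha).le
  have h4 : 1 + a * conj z ≠ 0 := by
    have := (map_ne_zero (starRingEnd ℂ)).2 h1
    simpa using this
  have h5 := one_sub_conj_mul_ne_zero hz (mem_disk.1 hw).le
  have e1 : mobius a z - mobius a w
      = (z - w) * (1 - conj a * a) / ((1 + conj a * z) * (1 + conj a * w)) := by
    simp only [mobius]
    rw [div_sub_div _ _ h1 h2]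
    congr 1
    ring
  have e2 : 1 - conj (mobius a z) * mobius a w
      = (1 - conj z * w) * (1 - conj a * a) / ((1 + a * conj z) * (1 + conj a * w)) := by
    simp only [mobius, map_div₀, map_add, map_one, map_mul, Complex.conj_conj]
    rw [div_mul_div_comm, one_sub_div (mul_ne_zero h4 h2)]
    congr 1
    ring
  have e3 : ‖1 + a * conj z‖ = ‖1 + conj a * z‖ := by
    rw [← Complex.norm_conj]; simp
  rw [rho_eq, e1, e2, rho_eq, norm_div, norm_div, norm_mul, norm_mul, norm_mul, norm_mul, e3,
    div_div_div_cancel_right₀ (mul_ne_zero (norm_ne_zero_iff.2 h1) (norm_ne_zero_iff.2 h2)),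
    mul_div_mul_right _ _ (norm_ne_zero_iff.2 h3)]

theorem rho_triangle {a b c : ℂ} (ha : a ∈ disk) (hb : b ∈ disk) (hc : c ∈ disk) :
    rho a c ≤ rho a b + rho b c := by
  have hb' := neg_mem_disk hb
  rw [← rho_mobius hb' ha hc, rho_comm a b]
  refine (rho_le_add_norm (mobius_mem_disk hb' ha) (mobius_mem_disk hb' hc)).trans ?_
  rw [norm_mobius, norm_mobius, neg_neg]

theorem continuousOn_rho {a : ℂ} (ha : a ∈ disk) :
    ContinuousOn (fun z => rho z a) (Metric.closedBall 0 1) := by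
  simp only [rho_comm _ a]
  unfold rho
  refine ContinuousOn.norm (ContinuousOn.div (by fun_prop) (by fun_prop) fun z hz => ?_)
  exact one_sub_conj_mul_ne_zero ha (by simpa using hz)

theorem rho_eq_one {a z : ℂ} (ha : a ∈ disk) (hz : ‖z‖ = 1) : rho z a = 1 := by
  have h := one_sub_rho_sq ha hz.le
  rw [hz, rho_comm] at h
  have h1 : rho z a ^ 2 = 1 := by
    have : (1 - ‖a‖ ^ 2) * (1 - 1 ^ 2) / ‖1 - conj a * z‖ ^ 2 = 0 := by simp
    linarith
  exact (pow_eq_one_iff_of_nonneg (rho_nonneg _ _) two_ne_zero).1 h1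

theorem differentiableOn_mobius {a : ℂ} (ha : a ∈ disk) : DifferentiableOn ℂ (mobius a) disk := by
  unfold mobius
  refine DifferentiableOn.div (by fun_prop) (by fun_prop) fun z hz => ?_
  exact one_add_conj_mul_ne_zero ha (mem_disk.1 hz).le

/-- Turns logarithms of factors bounded away from 0 into the quantities 1 - ρ², whose sum has a
harmonic majorant. -/
theorem neg_log_le {x d : ℝ} (hd : 0 < d) (hx : d ≤ x) (hx1 : x ≤ 1) :
    -Real.log x ≤ (1 - x ^ 2) / d := by
  have hx0 : 0 < x := hd.trans_le hx
  have h := Real.log_le_sub_one_of_pos (inv_pos.2 hx0)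
  rw [Real.log_inv] at h
  refine h.trans ?_
  have e : x⁻¹ - 1 = (1 - x) / x := by field_simp
  rw [e]
  have : 1 - x ≤ 1 - x ^ 2 := by nlinarith
  exact div_le_div₀ (by nlinarith) this hd hx

/-! ### Blaschke factors, Blaschke products and their derivatives -/

theorem one_sub_norm_pos {z : ℂ} (hz : z ∈ disk) : 0 < 1 - ‖z‖ := by
  rw [mem_disk] at hz; linarith

theorem isOpen_disk : IsOpen disk := Metric.isOpen_ball

theorem norm_blaschkeFactor (a z : ℂ) : ‖blaschkeFactor a z‖ = rho z a := by
  rw [rho_comm]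
  unfold blaschkeFactor rho
  split_ifs with h
  · simp [h]
  · have : ‖a‖ ≠ 0 := norm_ne_zero_iff.2 h
    simp [this]

/-- The unimodular factor ā/|a| makes 1 - |a| split off from b_a - 1, so the Blaschke condition
yields locally uniform convergence of the product. -/
theorem norm_blaschkeFactor_sub_one_le {a z : ℂ} (ha : a ∈ disk) (hz : z ∈ disk) :
    ‖blaschkeFactor a z - 1‖ ≤ 2 / (1 - ‖z‖) * (1 - ‖a‖) := by
  have h1 := one_sub_norm_pos hz
  have h2 := one_sub_norm_pos ha
  have hz' := mem_disk.1 hz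
  by_cases h : a = 0
  · subst h
    have : ‖z - 1‖ ≤ 2 := by
      refine (norm_sub_le _ _).trans ?_
      rw [norm_one]; linarith
    simp only [blaschkeFactor, if_true, norm_zero, sub_zero, mul_one]
    rw [le_div_iff₀ h1]
    nlinarith [norm_nonneg z, norm_nonneg (z - 1)]
  · have h3 := one_sub_conj_mul_ne_zero ha hz'.le
    have h4 : (‖a‖ : ℂ) ≠ 0 := by simpa using h
    have h5 : conj a * a = (‖a‖ : ℂ) ^ 2 := by
      rw [mul_comm, Complex.mul_conj, Complex.normSq_eq_norm_sq]; push_cast; rfl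
    have e : blaschkeFactor a z - 1
        = -((1 - ‖a‖ : ℝ) : ℂ) * (1 + conj a / (‖a‖ : ℂ) * z) / (1 - conj a * z) := by
      simp only [blaschkeFactor, if_neg h]
      rw [mul_div_assoc', div_sub_one h3]
      congr 1
      rw [mul_sub, div_mul_eq_mul_div, h5]
      push_cast
      have h6 : conj a = conj a / (‖a‖ : ℂ) * ‖a‖ := by field_simp
      have h7 : (‖a‖ : ℂ) ^ 2 / ‖a‖ = ‖a‖ := by field_simp
      rw [h7]
      linear_combination z * h6
    rw [e, norm_div, norm_mul, norm_neg, Complex.norm_real, Real.norm_of_nonneg h2.le]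
    have h8 : ‖1 + conj a / (‖a‖ : ℂ) * z‖ ≤ 2 := by
      refine (norm_add_le _ _).trans ?_
      have : ‖a‖ ≠ 0 := norm_ne_zero_iff.2 h
      rw [norm_mul, norm_div, Complex.norm_conj]
      simp [this]
      linarith
    refine (div_le_div₀ (c := (1 - ‖a‖) * 2) (by positivity) ?_ h1
      (one_sub_norm_le_norm_one_sub_conj_mul ha)).trans_eq (by ring)
    gcongr

theorem differentiableOn_blaschkeFactor {a : ℂ} (ha : a ∈ disk) :
    DifferentiableOn ℂ (blaschkeFactor a) disk := by
  unfold blaschkeFactor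
  split_ifs
  · fun_prop
  · refine DifferentiableOn.mul (by fun_prop) (DifferentiableOn.div (by fun_prop) (by fun_prop) ?_)
    exact fun z hz => one_sub_conj_mul_ne_zero ha (mem_disk.1 hz).le

variable {ι : Type*} {lam : ι → ℂ}

theorem IsBlaschkeSeq.subtype (h : IsBlaschkeSeq lam) (p : ι → Prop) :
    IsBlaschkeSeq (fun k : {k // p k} => lam k) :=
  ⟨fun n => h.1 n, h.2.comp_injective Subtype.val_injective⟩

theorem IsBlaschkeSeq.hasProdLocallyUniformlyOn (h : IsBlaschkeSeq lam) :
    HasProdLocallyUniformlyOn (fun n z => blaschkeFactor (lam n) z) (blaschke lam) disk := by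
  have key := hasProdLocallyUniformlyOn_of_forall_compact (f := fun n z => blaschkeFactor (lam n) z)
    (g := blaschke lam) isOpen_disk
  refine key fun K hK hc => ?_
  have h1 := Summable.hasProdUniformlyOn_one_add (f := fun n z => blaschkeFactor (lam n) z - 1) hc
    (u := fun n => sSup ((fun z => 2 / (1 - ‖z‖)) '' K) * (1 - ‖lam n‖)) (h.2.mul_left _) ?_ ?_
  · simp only [add_sub_cancel] at h1
    exact h1
  · refine Filter.Eventually.of_forall fun n z hz => ?_
    refine (norm_blaschkeFactor_sub_one_le (h.1 n) (hK hz)).trans ?_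
    refine mul_le_mul_of_nonneg_right ?_ (one_sub_norm_pos (h.1 n)).le
    refine le_csSup (hc.bddAbove_image ?_) (Set.mem_image_of_mem _ hz)
    exact ContinuousOn.div (by fun_prop) (by fun_prop) fun w hw => (one_sub_norm_pos (hK hw)).ne'
  · exact fun n => ((differentiableOn_blaschkeFactor (h.1 n)).mono hK).continuousOn.sub
      continuousOn_const

theorem IsBlaschkeSeq.hasProd (h : IsBlaschkeSeq lam) {z : ℂ} (hz : z ∈ disk) :
    HasProd (fun n => blaschkeFactor (lam n) z) (blaschke lam z) :=
  h.hasProdLocallyUniformlyOn.hasProd hz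

theorem IsBlaschkeSeq.differentiableOn (h : IsBlaschkeSeq lam) :
    DifferentiableOn ℂ (blaschke lam) disk := by
  refine TendstoLocallyUniformlyOn.differentiableOn h.hasProdLocallyUniformlyOn
    (Filter.Eventually.of_forall fun s => ?_) isOpen_disk
  exact DifferentiableOn.fun_finsetProd fun n _ => differentiableOn_blaschkeFactor (h.1 n)

theorem IsBlaschkeSeq.hasProd_norm (h : IsBlaschkeSeq lam) {z : ℂ} (hz : z ∈ disk) :
    HasProd (fun n => rho z (lam n)) ‖blaschke lam z‖ := by
  simpa only [norm_blaschkeFactor] using (h.hasProd hz).norm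

theorem IsBlaschkeSeq.le_norm_blaschke (h : IsBlaschkeSeq lam) {z : ℂ} (hz : z ∈ disk) {c : ℝ}
    (hc : ∀ F : Finset ι, c ≤ ∏ k ∈ F, rho z (lam k)) : c ≤ ‖blaschke lam z‖ :=
  ge_of_tendsto' (h.hasProd_norm hz) hc

theorem IsBlaschkeSeq.norm_blaschke_le (h : IsBlaschkeSeq lam) {z : ℂ} (hz : z ∈ disk)
    (F : Finset ι) : ‖blaschke lam z‖ ≤ ∏ k ∈ F, rho z (lam k) := by
  refine le_of_tendsto (h.hasProd_norm hz) ?_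
  filter_upwards [Filter.eventually_ge_atTop F] with G hG
  classical
  rw [← Finset.prod_sdiff hG]
  refine mul_le_of_le_one_left (Finset.prod_nonneg fun _ _ => rho_nonneg _ _) ?_
  exact Finset.prod_le_one (fun _ _ => rho_nonneg _ _) fun k _ => (rho_lt_one hz (h.1 k)).le

theorem IsBlaschkeSeq.norm_blaschke_le_one (h : IsBlaschkeSeq lam) {z : ℂ} (hz : z ∈ disk) :
    ‖blaschke lam z‖ ≤ 1 := by
  simpa using h.norm_blaschke_le hz ∅

theorem IsBlaschkeSeq.blaschke_eq_mul (h : IsBlaschkeSeq lam) {z : ℂ} (hz : z ∈ disk) (n : ι) :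
    blaschke lam z = blaschkeFactor (lam n) z * blaschkeDel lam n z := by
  have h1 : HasProd ((fun k => blaschkeFactor (lam k) z) ∘ ((↑) : ({n} : Set ι) → ι))
      (blaschkeFactor (lam n) z) := hasProd_unique (β := ({n} : Set ι)) _
  have h2 : HasProd ((fun k => blaschkeFactor (lam k) z) ∘ ((↑) : (({n} : Set ι)ᶜ : Set ι) → ι))
      (blaschkeDel lam n z) := (h.subtype (· ≠ n)).hasProd hz
  exact (h.hasProd hz).unique (h1.mul_compl h2)

theorem IsBlaschkeSeq.norm_blaschke_eq_mul (h : IsBlaschkeSeq lam) {z : ℂ} (hz : z ∈ disk)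
    (n : ι) : ‖blaschke lam z‖ = rho z (lam n) * ‖blaschkeDel lam n z‖ := by
  rw [h.blaschke_eq_mul hz n, norm_mul, norm_blaschkeFactor]

theorem IsBlaschkeSeq.differentiableOn_del (h : IsBlaschkeSeq lam) (n : ι) :
    DifferentiableOn ℂ (blaschkeDel lam n) disk :=
  (h.subtype (· ≠ n)).differentiableOn

theorem IsBlaschkeSeq.norm_blaschkeDel_le_one (h : IsBlaschkeSeq lam) (n : ι) {z : ℂ}
    (hz : z ∈ disk) : ‖blaschkeDel lam n z‖ ≤ 1 :=
  (h.subtype (· ≠ n)).norm_blaschke_le_one hz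

theorem IsBlaschkeSeq.le_norm_blaschkeDel (h : IsBlaschkeSeq lam) {z : ℂ} (hz : z ∈ disk) (n : ι)
    {c : ℝ} (hc : ∀ F : Finset ι, n ∉ F → c ≤ ∏ k ∈ F, rho z (lam k)) :
    c ≤ ‖blaschkeDel lam n z‖ := by
  refine (h.subtype (· ≠ n)).le_norm_blaschke hz fun F => ?_
  have := hc (F.map ⟨Subtype.val, Subtype.val_injective⟩) (by simp)
  simpa using this

theorem IsBlaschkeSeq.norm_blaschkeDel_le (h : IsBlaschkeSeq lam) {z : ℂ} (hz : z ∈ disk) (n : ι)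
    (F : Finset ι) (hF : n ∉ F) : ‖blaschkeDel lam n z‖ ≤ ∏ k ∈ F, rho z (lam k) := by
  classical
  have := (h.subtype (· ≠ n)).norm_blaschke_le hz (F.subtype (· ≠ n))
  refine this.trans_eq ?_
  exact Finset.prod_subtype_of_mem (fun k => rho z (lam k)) fun k hk hkn => hF (hkn ▸ hk)

theorem IsBlaschkeSeq.blaschkeDel_eq_zero (h : IsBlaschkeSeq lam) {m n : ι} (hmn : m ≠ n) :
    blaschkeDel lam n (lam m) = 0 := by
  have := h.norm_blaschkeDel_le (h.1 m) n {m} (by simpa using hmn.symm)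
  rw [Finset.prod_singleton, rho_self] at this
  exact norm_le_zero_iff.1 this

/-- The derivative of a Blaschke factor, with its natural normalisation. -/
theorem norm_deriv_blaschkeFactor {a z : ℂ} (ha : a ∈ disk) (hz : z ∈ disk) :
    (1 - ‖z‖ ^ 2) * ‖deriv (blaschkeFactor a) z‖ = 1 - rho z a ^ 2 := by
  have h3 := one_sub_conj_mul_ne_zero ha (mem_disk.1 hz).le
  have h1 : HasDerivAt (fun z => (a - z) / (1 - conj a * z))
      (-((1 - ‖a‖ ^ 2 : ℝ) : ℂ) / (1 - conj a * z) ^ 2) z := by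
    have := ((hasDerivAt_id z).const_sub a).fun_div
      (((hasDerivAt_id z).const_mul (conj a)).const_sub 1) h3
    simp only [id, mul_one] at this
    have h5 : conj a * a = (‖a‖ : ℂ) ^ 2 := by
      rw [mul_comm, Complex.mul_conj, Complex.normSq_eq_norm_sq]; push_cast; rfl
    refine this.congr_deriv ?_
    congr 1
    push_cast
    linear_combination h5
  have h2 : ‖deriv (blaschkeFactor a) z‖ = (1 - ‖a‖ ^ 2) / ‖1 - conj a * z‖ ^ 2 := by
    by_cases h : a = 0
    · subst h
      have : blaschkeFactor 0 = id := by funext w; simp [blaschkeFactor]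
      simp [this]
    · have e : blaschkeFactor a
          = fun z => conj a / (‖a‖ : ℂ) * ((a - z) / (1 - conj a * z)) := by
        funext w; simp [blaschkeFactor, h]
      have h4 : ‖a‖ ≠ 0 := norm_ne_zero_iff.2 h
      have h5 : 0 ≤ 1 - ‖a‖ ^ 2 := by
        have := mem_disk.1 ha
        nlinarith [norm_nonneg a]
      rw [e, (h1.const_mul _).deriv, norm_mul, norm_div, norm_div, norm_neg, norm_pow,
        Complex.norm_real, Complex.norm_real, Complex.norm_conj, norm_norm,
        Real.norm_of_nonneg h5, div_self h4, one_mul]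
  rw [h2, rho_comm, one_sub_rho_sq ha (mem_disk.1 hz).le]
  ring

theorem IsBlaschkeSeq.deriv_blaschke (h : IsBlaschkeSeq lam) {z : ℂ} (hz : z ∈ disk) (n : ι) :
    deriv (blaschke lam) z = deriv (blaschkeFactor (lam n)) z * blaschkeDel lam n z
      + blaschkeFactor (lam n) z * deriv (blaschkeDel lam n) z := by
  have hd := isOpen_disk.mem_nhds hz
  have e : blaschke lam =ᶠ[nhds z] fun z => blaschkeFactor (lam n) z * blaschkeDel lam n z := by
    filter_upwards [hd] with w hw using h.blaschke_eq_mul hw n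
  rw [e.deriv_eq]
  exact deriv_fun_mul ((differentiableOn_blaschkeFactor (h.1 n)).differentiableAt hd)
    ((h.differentiableOn_del n).differentiableAt hd)

theorem IsBlaschkeSeq.deriv_blaschke_self (h : IsBlaschkeSeq lam) (n : ι) :
    (1 - ‖lam n‖ ^ 2) * ‖deriv (blaschke lam) (lam n)‖ = ‖blaschkeDel lam n (lam n)‖ := by
  have h1 : blaschkeFactor (lam n) (lam n) = 0 := by
    rw [← norm_eq_zero, norm_blaschkeFactor, rho_self]
  have h2 := norm_deriv_blaschkeFactor (h.1 n) (h.1 n)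
  rw [h.deriv_blaschke (h.1 n) n, h1, zero_mul, add_zero, norm_mul, ← mul_assoc, h2, rho_self]
  simp

/-- A crude form of the Schwarz-Pick inequality. -/
theorem norm_deriv_le_four {f : ℂ → ℂ} (hf : DifferentiableOn ℂ f disk)
    (hb : ∀ z ∈ disk, ‖f z‖ ≤ 1) {z : ℂ} (hz : z ∈ disk) :
    (1 - ‖z‖ ^ 2) * ‖deriv f z‖ ≤ 4 := by
  have h1 := one_sub_norm_pos hz
  have hsub : Metric.ball z (1 - ‖z‖) ⊆ disk := by
    refine Metric.ball_subset_ball' ?_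
    simp
  -- Two values of f differ by at most 2, so |f'(z)| ≤ 2/(1 - |z|); the remaining factor 1 + |z| is
  -- at most 2.
  have := Complex.norm_deriv_le_div_of_mapsTo_ball (R₂ := 2) (hf.mono hsub) (fun w hw => ?_) h1
  · rw [le_div_iff₀ h1] at this
    have := norm_nonneg z
    have := mem_disk.1 hz
    nlinarith [norm_nonneg (deriv f z)]
  · rw [Metric.mem_closedBall, dist_eq_norm]
    refine (norm_sub_le _ _).trans ?_
    linarith [hb w (hsub hw), hb z hz]

/-! ### Positive harmonic functions and Harnack's inequality -/

theorem HarPos.pos {H : ℂ → ℝ} (h : HarPos H) {z : ℂ} (hz : z ∈ disk) : 0 < H z := h.2 z hz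

theorem HarPos.add {H₁ H₂ : ℂ → ℝ} (h₁ : HarPos H₁) (h₂ : HarPos H₂) :
    HarPos (fun z => H₁ z + H₂ z) :=
  ⟨h₁.1.add h₂.1, fun z hz => add_pos (h₁.2 z hz) (h₂.2 z hz)⟩

theorem HarPos.const_mul {H : ℂ → ℝ} (h : HarPos H) {c : ℝ} (hc : 0 < c) :
    HarPos (fun z => c * H z) :=
  ⟨h.1.const_smul (c := c), fun z hz => mul_pos hc (h.2 z hz)⟩

theorem harPos_const {c : ℝ} (hc : 0 < c) : HarPos (fun _ => c) :=
  ⟨InnerProductSpace.harmonicOnNhd_const c, fun _ _ => hc⟩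

theorem harPos_re {f : ℂ → ℂ} (hf : DifferentiableOn ℂ f disk) (hp : ∀ z ∈ disk, 0 < (f z).re) :
    HarPos (fun z => (f z).re) :=
  ⟨fun _ hz => (hf.analyticAt (isOpen_disk.mem_nhds hz)).harmonicAt_re, hp⟩

theorem HarPos.exists_re_eq {H : ℂ → ℝ} (h : HarPos H) :
    ∃ f : ℂ → ℂ, DifferentiableOn ℂ f disk ∧ ∀ z ∈ disk, (f z).re = H z := by
  obtain ⟨f, hf, he⟩ := h.1.exists_analyticOnNhd_ball_re_eq
  exact ⟨f, hf.differentiableOn, fun z hz => he hz⟩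

/-- The Schwarz lemma for `g ∘ mobius a`, which vanishes at 0. -/
theorem norm_comp_mobius_le {g : ℂ → ℂ} (hg : DifferentiableOn ℂ g disk)
    (hb : ∀ z ∈ disk, ‖g z‖ ≤ 1) {a z : ℂ} (ha : a ∈ disk) (hz : z ∈ disk) (h0 : g a = 0) :
    ‖g z‖ ≤ rho z a := by
  have ha' := neg_mem_disk ha
  have hw := mobius_mem_disk ha' hz
  have hm : Set.MapsTo (mobius a) disk disk := fun w hw => mobius_mem_disk ha hw
  have h := Complex.norm_le_norm_of_mapsTo_ball (f := g ∘ mobius a) (R := 1)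
    (hg.comp (differentiableOn_mobius ha) hm)
    (fun w hw => by simpa using hb _ (hm hw)) (by simpa [mobius] using h0) (mem_disk.1 hw)
  rwa [Function.comp, mobius_mobius_neg ha hz, norm_mobius, neg_neg, rho_comm] at h

/-- **Harnack's inequality** for positive harmonic functions in the disk. -/
theorem HarPos.harnack {H : ℂ → ℝ} (h : HarPos H) {z w : ℂ} (hz : z ∈ disk) (hw : w ∈ disk) :
    H w * (1 - rho z w) ≤ (1 + rho z w) * H z := by
  obtain ⟨f, hf, he⟩ := h.exists_re_eq
  have hne : ∀ v ∈ disk, f v + conj (f z) ≠ 0 := by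
    intro v hv h0
    have := congrArg Complex.re h0
    simp only [Complex.add_re, Complex.conj_re, Complex.zero_re, he v hv, he z hz] at this
    linarith [h.2 v hv, h.2 z hz]
  have hsub : ∀ v, ‖f v - f z‖ ^ 2 = ((f v).re - (f z).re) ^ 2 + ((f v).im - (f z).im) ^ 2 := by
    intro v
    rw [← Complex.normSq_eq_norm_sq, Complex.normSq_apply]
    simp; ring
  have hadd : ∀ v, ‖f v + conj (f z)‖ ^ 2
      = ((f v).re + (f z).re) ^ 2 + ((f v).im - (f z).im) ^ 2 := by
    intro v
    rw [← Complex.normSq_eq_norm_sq, Complex.normSq_apply]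
    simp; ring
  -- This Cayley transform sends the right half plane into the disk and f(z) to 0, so Schwarz
  -- applies to H = Re f.
  have key := norm_comp_mobius_le (g := fun v => (f v - f z) / (f v + conj (f z)))
    (DifferentiableOn.div (hf.sub_const _) (hf.add_const _) hne) (a := z) (fun v hv => ?_) hz hw
    (by simp)
  · have h1 := rho_nonneg z w
    have h2 := rho_lt_one hz hw
    rw [rho_comm] at key
    simp only [norm_div] at key
    rw [div_le_iff₀ (norm_pos_iff.2 (hne w hw))] at key
    have h3 := pow_le_pow_left₀ (norm_nonneg _) key 2
    rw [mul_pow, hsub, hadd, he w hw, he z hz] at h3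
    -- The imaginary parts enter both sides through the same square, and ρ ≤ 1 allows them to be
    -- dropped.
    have h4 : (H w - H z) ^ 2 ≤ (rho z w * (H w + H z)) ^ 2 := by
      have : rho z w ^ 2 * ((f w).im - (f z).im) ^ 2 ≤ ((f w).im - (f z).im) ^ 2 :=
        mul_le_of_le_one_left (sq_nonneg _) (pow_le_one₀ h1 h2.le)
      rw [mul_pow]
      linarith
    have h5 := (abs_le_of_sq_le_sq' h4
      (mul_nonneg h1 (add_pos (h.2 w hw) (h.2 z hz)).le)).2
    linarith
  · rw [norm_div]
    refine div_le_one_of_le₀ (le_of_sq_le_sq ?_ (norm_nonneg _)) (norm_nonneg _)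
    rw [hsub, hadd, he v hv, he z hz]
    nlinarith [h.2 v hv, h.2 z hz]

theorem HarPos.le_three_mul {H : ℂ → ℝ} (h : HarPos H) {z w : ℂ} (hz : z ∈ disk) (hw : w ∈ disk)
    (hr : rho z w ≤ 1 / 2) : H w ≤ 3 * H z := by
  have := h.harnack hz hw
  have h1 := h.2 z hz
  have h2 := h.2 w hw
  nlinarith

/-! ### The harmonic potential of a Blaschke sequence -/

theorem differentiableOn_tsum_disk {ι : Type*} {f : ι → ℂ → ℂ}
    (hf : ∀ n, DifferentiableOn ℂ (f n) disk)
    (hb : ∀ r < 1, ∃ u : ι → ℝ, Summable u ∧ ∀ n, ∀ z, ‖z‖ < r → ‖f n z‖ ≤ u n) :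
    DifferentiableOn ℂ (fun z => ∑' n, f n z) disk := by
  intro z hz
  obtain ⟨r, h1, h2⟩ := exists_between (mem_disk.1 hz)
  obtain ⟨u, hu, hfu⟩ := hb r h2
  have := Complex.differentiableOn_tsum_of_summable_norm hu
    (fun n => (hf n).mono (Metric.ball_subset_ball h2.le)) Metric.isOpen_ball
    (fun n w hw => hfu n w (by simpa using hw))
  exact (this.differentiableAt (Metric.isOpen_ball.mem_nhds (by simpa using h1))).differentiableWithinAt

/-- The Herglotz kernel with pole at `1 / conj a`. -/
noncomputable def herglotz (a z : ℂ) : ℂ := (1 + conj a * z) / (1 - conj a * z)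

theorem differentiableOn_herglotz {a : ℂ} (ha : a ∈ disk) :
    DifferentiableOn ℂ (herglotz a) disk := by
  unfold herglotz
  exact DifferentiableOn.div (by fun_prop) (by fun_prop) fun z hz =>
    one_sub_conj_mul_ne_zero ha (mem_disk.1 hz).le

theorem norm_herglotz_le {a z : ℂ} (ha : a ∈ disk) (hz : z ∈ disk) :
    ‖herglotz a z‖ ≤ 2 / (1 - ‖z‖) := by
  unfold herglotz
  rw [norm_div]
  refine div_le_div₀ zero_le_two ?_ (one_sub_norm_pos hz) (one_sub_norm_le_norm_one_sub_conj_mul ha)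
  refine (norm_add_le _ _).trans ?_
  rw [norm_one, norm_mul, Complex.norm_conj]
  have := mem_disk.1 ha
  have := mem_disk.1 hz
  nlinarith [norm_nonneg a, norm_nonneg z]

theorem herglotz_re (a z : ℂ) :
    (herglotz a z).re = (1 - ‖a‖ ^ 2 * ‖z‖ ^ 2) / ‖1 - conj a * z‖ ^ 2 := by
  unfold herglotz
  rw [Complex.div_re, ← add_div, Complex.normSq_eq_norm_sq]
  congr 1
  simp only [← Complex.normSq_eq_norm_sq, Complex.normSq_apply, Complex.sub_re, Complex.sub_im,
    Complex.mul_re, Complex.mul_im, Complex.conj_re, Complex.conj_im, Complex.one_re,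
    Complex.one_im, Complex.add_re, Complex.add_im]
  ring

theorem one_sub_norm_sq_div_le_herglotz {a z : ℂ} (hz : z ∈ disk) :
    (1 - ‖a‖ ^ 2) / ‖1 - conj a * z‖ ^ 2 ≤ (herglotz a z).re := by
  rw [herglotz_re]
  have := mem_disk.1 hz
  gcongr
  exact mul_le_of_le_one_right (sq_nonneg _) (pow_le_one₀ (norm_nonneg _) this.le)

theorem one_sub_norm_sq_pos {z : ℂ} (hz : z ∈ disk) : 0 < 1 - ‖z‖ ^ 2 := by
  have := mem_disk.1 hz
  nlinarith [norm_nonneg z]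

theorem herglotz_re_pos {a z : ℂ} (ha : a ∈ disk) (hz : z ∈ disk) : 0 < (herglotz a z).re := by
  refine lt_of_lt_of_le ?_ (one_sub_norm_sq_div_le_herglotz hz)
  have := one_sub_norm_sq_pos ha
  have := norm_pos_iff.2 (one_sub_conj_mul_ne_zero ha (mem_disk.1 hz).le)
  positivity

/-- Enlarging the numerator 1 - |z|² of (1 - ρ²)/(1 - |a|²) to 1 - |a|²|z|² turns the quotient into
the real part of a holomorphic function, hence into a harmonic one. -/
theorem one_sub_rho_sq_le {a z : ℂ} (ha : a ∈ disk) (hz : z ∈ disk) :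
    1 - rho z a ^ 2 ≤ (1 - ‖a‖ ^ 2) * (herglotz a z).re := by
  rw [rho_comm, one_sub_rho_sq ha (mem_disk.1 hz).le, mul_div_assoc]
  refine mul_le_mul_of_nonneg_left ?_ (one_sub_norm_sq_pos ha).le
  rw [herglotz_re]
  have := mem_disk.1 ha
  gcongr
  exact mul_le_of_le_one_left (sq_nonneg _) (pow_le_one₀ (norm_nonneg _) this.le)

/-- The positive harmonic function `∑ (1 - |λₙ|²) Re ((1 + conj λₙ z) / (1 - conj λₙ z))`. -/
noncomputable def blaschkePotential (lam : ι → ℂ) (z : ℂ) : ℝ :=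
  ∑' n, (1 - ‖lam n‖ ^ 2) * (herglotz (lam n) z).re

theorem IsBlaschkeSeq.summable_sq (h : IsBlaschkeSeq lam) : Summable fun n => 1 - ‖lam n‖ ^ 2 := by
  refine Summable.of_nonneg_of_le (fun n => (one_sub_norm_sq_pos (h.1 n)).le) (fun n => ?_)
    (h.2.mul_left 2)
  nlinarith [sq_nonneg (1 - ‖lam n‖)]

theorem IsBlaschkeSeq.norm_herglotz_term_le (h : IsBlaschkeSeq lam) {r : ℝ} (hr : r < 1) (n : ι)
    {z : ℂ} (hz : ‖z‖ ≤ r) :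
    ‖((1 - ‖lam n‖ ^ 2 : ℝ) : ℂ) * herglotz (lam n) z‖ ≤ (1 - ‖lam n‖ ^ 2) * (2 / (1 - r)) := by
  have h1 := one_sub_norm_sq_pos (h.1 n)
  rw [norm_mul, Complex.norm_real, Real.norm_of_nonneg h1.le]
  refine mul_le_mul_of_nonneg_left ?_ h1.le
  refine (norm_herglotz_le (h.1 n) (mem_disk.2 (hz.trans_lt hr))).trans ?_
  have : 0 < 1 - r := by linarith
  gcongr

theorem IsBlaschkeSeq.hasSum_potential (h : IsBlaschkeSeq lam) {z : ℂ} (hz : z ∈ disk) :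
    HasSum (fun n => (1 - ‖lam n‖ ^ 2) * (herglotz (lam n) z).re) (blaschkePotential lam z) := by
  refine Summable.hasSum ?_
  refine (h.summable_sq.mul_right (2 / (1 - ‖z‖))).of_norm_bounded fun n => ?_
  refine le_trans ?_ (h.norm_herglotz_term_le (mem_disk.1 hz) n le_rfl)
  rw [norm_mul, norm_mul, Complex.norm_real]
  gcongr
  exact Complex.abs_re_le_norm _

theorem IsBlaschkeSeq.harPos_potential [Nonempty ι] (h : IsBlaschkeSeq lam) :
    HarPos (blaschkePotential lam) := by
  have h1 : DifferentiableOn ℂ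
      (fun z => ∑' n, ((1 - ‖lam n‖ ^ 2 : ℝ) : ℂ) * herglotz (lam n) z) disk := by
    refine differentiableOn_tsum_disk
      (fun n => (differentiableOn_herglotz (h.1 n)).const_mul _) fun r hr => ?_
    exact ⟨_, h.summable_sq.mul_right (2 / (1 - r)),
      fun n z hz => h.norm_herglotz_term_le hr n hz.le⟩
  have h2 : ∀ z ∈ disk, (∑' n, ((1 - ‖lam n‖ ^ 2 : ℝ) : ℂ) * herglotz (lam n) z).re
      = blaschkePotential lam z := by
    intro z hz
    have hs : Summable fun n => ((1 - ‖lam n‖ ^ 2 : ℝ) : ℂ) * herglotz (lam n) z :=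
      (h.summable_sq.mul_right (2 / (1 - ‖z‖))).of_norm_bounded fun n =>
        h.norm_herglotz_term_le (mem_disk.1 hz) n le_rfl
    rw [Complex.re_tsum hs]
    simp only [Complex.re_ofReal_mul]
    rfl
  have hpos : ∀ z ∈ disk, 0 < blaschkePotential lam z := by
    intro z hz
    have ht : ∀ n, 0 < (1 - ‖lam n‖ ^ 2) * (herglotz (lam n) z).re := fun n =>
      mul_pos (one_sub_norm_sq_pos (h.1 n)) (herglotz_re_pos (h.1 n) hz)
    exact (h.hasSum_potential hz).summable.tsum_pos (fun n => (ht n).le) (Classical.arbitrary ι)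
      (ht _)
  have h3 := harPos_re h1 fun z hz => by rw [h2 z hz]; exact hpos z hz
  refine ⟨fun z hz => ?_, hpos⟩
  refine (InnerProductSpace.harmonicAt_congr_nhds ?_).1 (h3.1 z hz)
  filter_upwards [isOpen_disk.mem_nhds hz] with w hw using h2 w hw

theorem IsBlaschkeSeq.sum_one_sub_rho_sq_le (h : IsBlaschkeSeq lam) {z : ℂ} (hz : z ∈ disk)
    (F : Finset ι) : ∑ k ∈ F, (1 - rho z (lam k) ^ 2) ≤ blaschkePotential lam z := by
  refine (Finset.sum_le_sum fun k _ => one_sub_rho_sq_le (h.1 k) hz).trans ?_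
  refine sum_le_hasSum F (fun k _ => ?_) (h.hasSum_potential hz)
  exact (mul_pos (one_sub_norm_sq_pos (h.1 k)) (herglotz_re_pos (h.1 k) hz)).le

theorem IsBlaschkeSeq.summable_one_sub_rho_sq (h : IsBlaschkeSeq lam) {z : ℂ} (hz : z ∈ disk) :
    Summable fun n => 1 - rho z (lam n) ^ 2 := by
  refine Summable.of_nonneg_of_le (fun n => ?_) (fun n => one_sub_rho_sq_le (h.1 n) hz)
    (h.hasSum_potential hz).summable
  have := rho_lt_one hz (h.1 n)
  nlinarith [rho_nonneg z (lam n)]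

theorem IsBlaschkeSeq.finite_rho_le (h : IsBlaschkeSeq lam) {z : ℂ} (hz : z ∈ disk) {r : ℝ}
    (hr : r < 1) : {n | rho z (lam n) ≤ r}.Finite := by
  have h1 := (h.summable_one_sub_rho_sq hz).tendsto_cofinite_zero
  have h2 := h1.eventually_lt_const (sub_pos.2 hr)
  rw [Filter.eventually_cofinite] at h2
  refine h2.subset fun n hn => ?_
  have := rho_nonneg z (lam n)
  simp only [Set.mem_ofPred_eq, not_lt] at hn ⊢
  nlinarith

/-- The far part of every logarithmic sum is harmless: it costs only a multiple of the potential,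
with no separation hypothesis. -/
theorem IsBlaschkeSeq.sum_neg_log_rho_le (h : IsBlaschkeSeq lam) {z : ℂ} (hz : z ∈ disk) {d : ℝ}
    (hd : 0 < d) {F : Finset ι} (hF : ∀ k ∈ F, d ≤ rho z (lam k)) :
    ∑ k ∈ F, -Real.log (rho z (lam k)) ≤ blaschkePotential lam z / d := by
  refine (Finset.sum_le_sum fun k hk => neg_log_le hd (hF k hk) (rho_lt_one hz (h.1 k)).le).trans ?_
  rw [← Finset.sum_div]
  gcongr
  exact h.sum_one_sub_rho_sq_le hz F

/-- Each near point contributes at least 1/2 to the sum of 1 - ρ². This count pays for losing log 2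
per near point later on. -/
theorem IsBlaschkeSeq.card_mul_le (h : IsBlaschkeSeq lam) {z : ℂ} (hz : z ∈ disk)
    {F : Finset ι} (hF : ∀ k ∈ F, rho z (lam k) ≤ 1 / 2) :
    (F.card : ℝ) ≤ 2 * blaschkePotential lam z := by
  have h1 := h.sum_one_sub_rho_sq_le hz F
  have h2 : ∑ k ∈ F, (1 / 2 : ℝ) ≤ ∑ k ∈ F, (1 - rho z (lam k) ^ 2) := by
    refine Finset.sum_le_sum fun k hk => ?_
    have := hF k hk
    nlinarith [rho_nonneg z (lam k)]
  rw [Finset.sum_const, nsmul_eq_mul] at h2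
  linarith

/-- The infimum `ρ(z, Λ)` is attained. -/
theorem IsBlaschkeSeq.exists_nearest [Nonempty ι] (h : IsBlaschkeSeq lam) {z : ℂ} (hz : z ∈ disk) :
    ∃ n, ∀ k, rho z (lam n) ≤ rho z (lam k) := by
  obtain ⟨m⟩ := ‹Nonempty ι›
  obtain ⟨n, hn, hmin⟩ := Set.exists_min_image _ (fun k => rho z (lam k))
    (h.finite_rho_le hz (rho_lt_one hz (h.1 m))) ⟨m, by simp⟩
  have hn' : rho z (lam n) ≤ rho z (lam m) := by simpa using hn
  refine ⟨n, fun k => ?_⟩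
  by_cases hk : rho z (lam k) ≤ rho z (lam m)
  · exact hmin k (by simpa using hk)
  · exact hn'.trans (not_le.1 hk).le

theorem rhoSet_le (z : ℂ) (lam : ι → ℂ) (n : ι) : rhoSet z lam ≤ rho z (lam n) :=
  ciInf_le ⟨0, by rintro _ ⟨k, rfl⟩; exact rho_nonneg _ _⟩ n

theorem rhoSet_eq [Nonempty ι] {z : ℂ} {n : ι} (hn : ∀ k, rho z (lam n) ≤ rho z (lam k)) :
    rhoSet z lam = rho z (lam n) :=
  le_antisymm (rhoSet_le z lam n) (le_ciInf hn)

/-! ### Interpolation by an explicit series -/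

theorem nevanlinna_of_norm_le_exp {f : ℂ → ℂ} (hf : DifferentiableOn ℂ f disk) {H : ℂ → ℝ}
    (hH : HarPos H) (h : ∀ z ∈ disk, ‖f z‖ ≤ Real.exp (H z)) : Nevanlinna f := by
  refine ⟨hf, H, hH, fun z hz => ?_⟩
  rw [Real.posLog_apply]
  refine max_le (hH.pos hz).le ?_
  rcases eq_or_ne ‖f z‖ 0 with h0 | h0
  · rw [h0, Real.log_zero]; exact (hH.pos hz).le
  · exact (Real.log_le_iff_le_exp ((norm_nonneg _).lt_of_ne' h0)).2 (h z hz)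

theorem Nevanlinna.exists_norm_le_exp {f : ℂ → ℂ} (hf : Nevanlinna f) :
    ∃ H, HarPos H ∧ ∀ z ∈ disk, ‖f z‖ ≤ Real.exp (H z) := by
  obtain ⟨-, H, hH, h⟩ := hf
  refine ⟨H, hH, fun z hz => ?_⟩
  rcases eq_or_ne ‖f z‖ 0 with h0 | h0
  · rw [h0]; positivity
  · refine (Real.log_le_iff_le_exp ((norm_nonneg _).lt_of_ne' h0)).1 (le_trans ?_ (h z hz))
    rw [Real.posLog_apply]
    exact le_max_right _ _

/-- B_n vanishes at all other nodes, and exp(g(z) - g(λ_n)) with Re g = G transfers the growth of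
the data to the function. The square of the kernel (1 - |λ_n|²)/(1 - λ̄_n z) equals 1 at λ_n and is
bounded by the n-th term of the potential, so the series converges and its sum is at most K. -/
theorem IsBlaschkeSeq.exists_interpolating [Nonempty ι] (h : IsBlaschkeSeq lam) {G : ℂ → ℝ}
    (hG : HarPos G) {w : ι → ℂ}
    (hw : ∀ n, ‖w n‖ ≤ Real.exp (G (lam n)) * ‖blaschkeDel lam n (lam n)‖) :
    w ∈ traceSpace lam := by
  obtain ⟨g, hg, hgG⟩ := hG.exists_re_eq
  set S : ι → ℂ → ℂ := fun n z =>
    (w n / blaschkeDel lam n (lam n) * Complex.exp (-g (lam n))) *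
      (blaschkeDel lam n z * (((1 - ‖lam n‖ ^ 2 : ℝ) : ℂ) / (1 - conj (lam n) * z)) ^ 2) with hS
  have hSle : ∀ n, ∀ z ∈ disk, ‖S n z‖ ≤ (1 - ‖lam n‖ ^ 2) * (herglotz (lam n) z).re := by
    intro n z hz
    have h1 := one_sub_norm_sq_pos (h.1 n)
    have e1 : ‖w n / blaschkeDel lam n (lam n) * Complex.exp (-g (lam n))‖ ≤ 1 := by
      rw [norm_mul, norm_div, Complex.norm_exp, Complex.neg_re, hgG _ (h.1 n), Real.exp_neg]
      rw [← div_eq_mul_inv]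
      refine div_le_one_of_le₀ ?_ (Real.exp_pos _).le
      exact div_le_of_le_mul₀ (norm_nonneg _) (Real.exp_pos _).le (hw n)
    have e2 : ‖(((1 - ‖lam n‖ ^ 2 : ℝ) : ℂ) / (1 - conj (lam n) * z)) ^ 2‖
        ≤ (1 - ‖lam n‖ ^ 2) * (herglotz (lam n) z).re := by
      rw [norm_pow, norm_div, Complex.norm_real, Real.norm_of_nonneg h1.le, div_pow, sq (1 - _),
        mul_div_assoc]
      exact mul_le_mul_of_nonneg_left (one_sub_norm_sq_div_le_herglotz hz) h1.le
    rw [hS]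
    simp only [norm_mul] at e1 ⊢
    calc _ ≤ 1 * (1 * ((1 - ‖lam n‖ ^ 2) * (herglotz (lam n) z).re)) := by
          gcongr
          exact h.norm_blaschkeDel_le_one n hz
      _ = _ := by ring
  have hSle' : ∀ n, ∀ z ∈ disk, ∀ r < 1, ‖z‖ ≤ r → ‖S n z‖ ≤ (1 - ‖lam n‖ ^ 2) * (2 / (1 - r)) := by
    intro n z hz r hr hzr
    refine (hSle n z hz).trans (le_trans ?_ (h.norm_herglotz_term_le hr n hzr))
    rw [norm_mul, Complex.norm_real]
    exact mul_le_mul (Real.le_norm_self _) (Complex.re_le_norm _) (herglotz_re_pos (h.1 n) hz).le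
      (norm_nonneg _)
  have hSd : ∀ n, DifferentiableOn ℂ (S n) disk := fun n =>
    ((h.differentiableOn_del n).mul ((DifferentiableOn.div (by fun_prop) (by fun_prop) fun z hz =>
      one_sub_conj_mul_ne_zero (h.1 n) (mem_disk.1 hz).le).pow 2)).const_mul _
  have hd := differentiableOn_tsum_disk hSd fun r hr =>
    ⟨_, h.summable_sq.mul_right (2 / (1 - r)),
      fun n z hz => hSle' n z (mem_disk.2 (hz.trans hr)) r hr hz.le⟩
  refine ⟨fun z => Complex.exp (g z) * ∑' n, S n z, ?_, fun m => ?_⟩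
  · refine nevanlinna_of_norm_le_exp (hg.cexp.mul hd) (hG.add h.harPos_potential) fun z hz => ?_
    rw [norm_mul, Complex.norm_exp, hgG z hz, Real.exp_add]
    refine mul_le_mul_of_nonneg_left ?_ (Real.exp_pos _).le
    refine (tsum_of_norm_bounded (h.hasSum_potential hz) fun n => hSle n z hz).trans ?_
    linarith [Real.add_one_le_exp (blaschkePotential lam z)]
  · have h0 : ∀ n, n ≠ m → S n (lam m) = 0 := by
      intro n hn
      simp only [hS, h.blaschkeDel_eq_zero hn.symm, zero_mul, mul_zero]
    have h1 : (((1 - ‖lam m‖ ^ 2 : ℝ) : ℂ) / (1 - conj (lam m) * lam m)) = 1 := by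
      have e : ((1 - ‖lam m‖ ^ 2 : ℝ) : ℂ) = 1 - conj (lam m) * lam m := by
        rw [mul_comm, Complex.mul_conj, Complex.normSq_eq_norm_sq]; push_cast; rfl
      rw [e, div_self (one_sub_conj_mul_ne_zero (h.1 m) (mem_disk.1 (h.1 m)).le)]
    -- Injectivity of `lam` is not assumed, so the divisor may be 0; the hypothesis on `w` then
    -- forces `w m = 0`.
    have h2 : w m / blaschkeDel lam m (lam m) * blaschkeDel lam m (lam m) = w m := by
      refine div_mul_cancel_of_imp fun hb => ?_
      have := hw m
      rw [hb, norm_zero, mul_zero] at this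
      exact norm_le_zero_iff.1 this
    show Complex.exp (g (lam m)) * ∑' n, S n (lam m) = w m
    rw [tsum_eq_single m h0]
    simp only [hS, h1, one_pow, mul_one]
    calc _ = (Complex.exp (g (lam m)) * Complex.exp (-g (lam m))) *
          (w m / blaschkeDel lam m (lam m) * blaschkeDel lam m (lam m)) := by ring
      _ = w m := by rw [← Complex.exp_add, add_neg_cancel, Complex.exp_zero, one_mul, h2]

theorem IsBlaschkeSeq.isInterpolating [Nonempty ι] (h : IsBlaschkeSeq lam) {H : ℂ → ℝ}
    (hH : HarPos H) (hB : ∀ n, Real.exp (-H (lam n)) ≤ ‖blaschkeDel lam n (lam n)‖) :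
    IsInterpolating lam := by
  rintro w ⟨f, hf, hfw⟩ v ⟨C, hC⟩
  obtain ⟨H', hH', hfH⟩ := hf.exists_norm_le_exp
  -- The constant absorbs the bounded multiplier, as exp(|C| + 1) ≥ C; the added 1 keeps it
  -- positive.
  refine h.exists_interpolating ((hH'.add hH).add (harPos_const (c := |C| + 1) (by positivity)))
    fun n => ?_
  rw [norm_mul, ← hfw n]
  have h1 : ‖v n‖ ≤ Real.exp (|C| + 1) := by
    have := Real.add_one_le_exp (|C| + 1)
    linarith [hC n, le_abs_self C]
  calc ‖v n‖ * ‖f (lam n)‖ ≤ Real.exp (|C| + 1) * Real.exp (H' (lam n)) :=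
        mul_le_mul h1 (hfH _ (h.1 n)) (norm_nonneg _) (Real.exp_pos _).le
    _ = Real.exp (H' (lam n) + H (lam n) + (|C| + 1)) * Real.exp (-H (lam n)) := by
        rw [← Real.exp_add, ← Real.exp_add]; ring_nf
    _ ≤ _ := mul_le_mul_of_nonneg_left (hB n) (Real.exp_pos _).le

/-! ### Division by zeros -/

/-- A bounded holomorphic function is dominated by the Blaschke product of finitely many of its
zeros. -/
theorem norm_le_prod_rho (hinj : Function.Injective lam) (F : Finset ι)
    (hlam : ∀ k, lam k ∈ disk) :
    ∀ g : ℂ → ℂ, DifferentiableOn ℂ g disk → (∀ z ∈ disk, ‖g z‖ ≤ 1) →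
      (∀ k ∈ F, g (lam k) = 0) → ∀ z ∈ disk, ‖g z‖ ≤ ∏ k ∈ F, rho z (lam k) := by
  classical
  induction F using Finset.induction_on with
  | empty => intro g _ hb _ z hz; simpa using hb z hz
  | insert m F hm ih =>
    intro g hg hb h0 z hz
    set a := lam m with ha_def
    have ha : a ∈ disk := hlam m
    have hga : g a = 0 := h0 m (Finset.mem_insert_self _ _)
    -- Up to a unimodular constant this is g/b_a, with the singularity at a removed by `dslope`.
    -- Schwarz bounds it by 1 away from a, and continuity does so at a.
    set g₁ : ℂ → ℂ := fun z => dslope g a z * (1 - conj a * z) with hg₁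
    have hd : DifferentiableOn ℂ g₁ disk :=
      ((Complex.differentiableOn_dslope (isOpen_disk.mem_nhds ha)).2 hg).mul (by fun_prop)
    have hne : ∀ w, w ≠ a → g₁ w = (g w) * (1 - conj a * w) / (w - a) := by
      intro w hw
      simp only [hg₁, dslope_of_ne _ hw, slope_def_field, hga, sub_zero]
      ring
    have hnorm : ∀ w ∈ disk, ‖g w‖ = rho w a * ‖g₁ w‖ := by
      intro w hw
      rcases eq_or_ne w a with rfl | hwa
      · rw [hga, rho_self, norm_zero, zero_mul]
      · have h1 := norm_ne_zero_iff.2 (sub_ne_zero.2 hwa)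
        have h2 := norm_ne_zero_iff.2 (one_sub_conj_mul_ne_zero ha (mem_disk.1 hw).le)
        rw [hne w hwa, rho_comm, rho_eq, norm_div, norm_mul, norm_sub_rev a w,
          div_mul_div_comm, mul_comm ‖1 - conj a * w‖ ‖w - a‖, mul_comm ‖w - a‖ (_ * _), mul_assoc,
          mul_comm ‖1 - conj a * w‖ ‖w - a‖, mul_div_cancel_right₀ _ (mul_ne_zero h1 h2)]
    have hb₁ : ∀ w ∈ disk, ‖g₁ w‖ ≤ 1 := by
      have hb' : ∀ w ∈ disk, w ≠ a → ‖g₁ w‖ ≤ 1 := by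
        intro w hw hwa
        have h1 := norm_comp_mobius_le hg hb ha hw hga
        rw [hnorm w hw] at h1
        have := rho_pos hw ha hwa
        exact le_of_mul_le_mul_left (by linarith) this
      intro w hw
      rcases eq_or_ne w a with rfl | hwa
      · have hc := ((hd.differentiableAt (isOpen_disk.mem_nhds hw)).continuousAt.norm).continuousWithinAt
          (s := {a}ᶜ)
        refine le_of_tendsto hc ?_
        filter_upwards [self_mem_nhdsWithin,
          mem_nhdsWithin_of_mem_nhds (isOpen_disk.mem_nhds hw)] with v hv hvd using hb' v hvd hv
      · exact hb' w hw hwa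
    have h0' : ∀ k ∈ F, g₁ (lam k) = 0 := by
      intro k hk
      have hka : lam k ≠ a := fun e => hm (hinj e ▸ hk)
      rw [hne _ hka, h0 k (Finset.mem_insert_of_mem hk), zero_mul, zero_div]
    rw [Finset.prod_insert hm, hnorm z hz]
    exact mul_le_mul_of_nonneg_left (ih g₁ hd hb₁ h0' z hz) (rho_nonneg _ _)

/-- Multiplying f by exp(-h), where Re h = H, reduces to the bounded case without changing the
zeros. -/
theorem norm_le_exp_mul_prod_rho (hinj : Function.Injective lam) (hlam : ∀ k, lam k ∈ disk)
    {H : ℂ → ℝ} (hH : HarPos H) {f : ℂ → ℂ} (hf : DifferentiableOn ℂ f disk)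
    (hfH : ∀ z ∈ disk, ‖f z‖ ≤ Real.exp (H z)) {F : Finset ι} (hF : ∀ k ∈ F, f (lam k) = 0)
    {z : ℂ} (hz : z ∈ disk) : ‖f z‖ ≤ Real.exp (H z) * ∏ k ∈ F, rho z (lam k) := by
  obtain ⟨h, hh, hre⟩ := hH.exists_re_eq
  have hn : ∀ w ∈ disk, ‖f w * Complex.exp (-h w)‖ = ‖f w‖ / Real.exp (H w) := by
    intro w hw
    rw [norm_mul, Complex.norm_exp, Complex.neg_re, hre w hw, Real.exp_neg, div_eq_mul_inv]
  have := norm_le_prod_rho hinj F hlam (fun w => f w * Complex.exp (-h w)) (hf.mul hh.neg.cexp)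
    (fun w hw => ?_) (fun k hk => by simp [hF k hk]) z hz
  · rw [hn z hz, div_le_iff₀ (Real.exp_pos _)] at this
    linarith
  · rw [hn w hw]
    exact div_le_one_of_le₀ (hfH w hw) (Real.exp_pos _).le

/-! ### Balanced cuts of weighted graphs -/

section Cut

/-- In a finite weighted graph there is a cut such that each vertex has at least half of its weight
across the cut. -/
theorem exists_finset_cut (w : ι → ι → ℝ) (hsymm : ∀ i j, w i j = w j i) (hdiag : ∀ i, w i i = 0)
    (G : Finset ι) :
    ∃ χ : ι → Prop, ∀ n ∈ G, ∀ [DecidablePred fun k => (χ k ↔ χ n)],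
      ∑ k ∈ G, w n k ≤ 2 * ∑ k ∈ G with ¬(χ k ↔ χ n), w n k := by
  classical
  let s : Finset ι → ι → ℝ := fun A i => if i ∈ A then 1 else -1
  let E : Finset ι → ℝ := fun A => ∑ i ∈ G, ∑ j ∈ G, w i j * (s A i * s A j)
  -- A maximal cut, encoded as ±1 spins of minimal energy. Flipping the spin of n cannot lower the
  -- energy, so the weight at n inside its own side is at most the weight across.
  obtain ⟨A, hA, hmin⟩ := Finset.exists_min_image G.powerset E ⟨∅, by simp⟩
  have hs : ∀ B i, s B i * s B i = 1 := by
    intro B i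
    simp only [s]
    split_ifs <;> norm_num
  refine ⟨(· ∈ A), fun n hn _ => ?_⟩
  have hflip : ∀ i, s (symmDiff A {n}) i = s A i - 2 * s A n * (if i = n then 1 else 0) := by
    intro i
    simp only [s, Finset.mem_symmDiff, Finset.mem_singleton]
    by_cases hi : i = n
    · subst hi
      by_cases hiA : i ∈ A <;> simp [hiA] <;> norm_num
    · simp [hi]
  have hE : E (symmDiff A {n}) = E A - 4 * ∑ j ∈ G, w n j * (s A n * s A j) := by
    have h1 : ∀ i j, w i j * (s (symmDiff A {n}) i * s (symmDiff A {n}) j)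
        = w i j * (s A i * s A j) - (if i = n then 2 * (w n j * (s A n * s A j)) else 0)
          - (if j = n then 2 * (w n i * (s A n * s A i)) else 0) := by
      intro i j
      rw [hflip i, hflip j]
      by_cases hi : i = n <;> by_cases hj : j = n
      · subst hi; subst hj; simp [hdiag]
      · subst hi; simp [hj]; ring
      · subst hj; simp [hi, hsymm i j]; ring
      · simp [hi, hj]
    simp only [E, h1, Finset.sum_sub_distrib, Finset.sum_ite_eq', if_pos hn]
    have h2 : ∀ i, (∑ j ∈ G, if i = n then 2 * (w n j * (s A n * s A j)) else 0)
        = if i = n then ∑ j ∈ G, 2 * (w n j * (s A n * s A j)) else 0 := by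
      intro i; split_ifs <;> simp
    simp only [h2, Finset.sum_ite_eq', if_pos hn, ← Finset.mul_sum]
    ring
  have hmem : symmDiff A {n} ∈ G.powerset := by
    rw [Finset.mem_powerset] at hA ⊢
    intro i hi
    rcases Finset.mem_symmDiff.1 hi with h | h
    · exact hA h.1
    · rw [Finset.mem_singleton.1 h.1]; exact hn
  have h3 := hmin _ hmem
  rw [hE] at h3
  have h4 : ∑ j ∈ G, w n j * (s A n * s A j)
      = ∑ k ∈ G, w n k - 2 * ∑ k ∈ G with ¬(k ∈ A ↔ n ∈ A), w n k := by
    rw [Finset.sum_filter, Finset.mul_sum, ← Finset.sum_sub_distrib]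
    refine Finset.sum_congr rfl fun k _ => ?_
    simp only [s]
    by_cases hk : k ∈ A <;> by_cases hnA : n ∈ A <;> simp [hk, hnA] <;> ring
  have h5 : ∑ k ∈ G with ¬(k ∈ A ↔ n ∈ A), w n k
      = ∑ k ∈ G with ¬((fun x => x ∈ A) k ↔ (fun x => x ∈ A) n), w n k := by
    refine Finset.sum_congr ?_ fun _ _ => rfl
    ext k; simp only [Finset.mem_filter]
  linarith

/-- **Mills' lemma**: a summable weighted graph has a cut such that each vertex has at least half of
its weight across the cut. -/
theorem exists_cut (w : ι → ι → ℝ) (hsymm : ∀ i j, w i j = w j i) (hdiag : ∀ i, w i i = 0)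
    (hnonneg : ∀ i j, 0 ≤ w i j) (hsum : ∀ i, Summable (w i)) :
    ∃ S : Set ι, ∀ n, ∀ c : ℝ,
      (∀ T : Finset ι, (∀ k ∈ T, ¬(k ∈ S ↔ n ∈ S)) → ∑ k ∈ T, w n k ≤ c) →
      ∀ T : Finset ι, ∑ k ∈ T, w n k ≤ 2 * c := by
  classical
  choose χ hχ using exists_finset_cut w hsymm hdiag
  -- Compactness: the cuts of the finite subgraphs have a limit along an ultrafilter, with which
  -- they agree on any prescribed finite set.
  let U : Ultrafilter (Finset ι) := Ultrafilter.of Filter.atTop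
  have hU : (U : Filter (Finset ι)) ≤ Filter.atTop := Ultrafilter.of_le _
  set S : Set ι := {k | ∀ᶠ G in (U : Filter (Finset ι)), χ G k} with hS
  have hSU : ∀ k, ∀ᶠ G in (U : Filter (Finset ι)), (χ G k ↔ k ∈ S) := by
    intro k
    by_cases hk : k ∈ S
    · have hk' : ∀ᶠ G in (U : Filter (Finset ι)), χ G k := hk
      filter_upwards [hk'] with G hG
      exact ⟨fun _ => hk, fun _ => hG⟩
    · have hk' : ∀ᶠ G in (U : Filter (Finset ι)), ¬ χ G k := Ultrafilter.eventually_not.2 hk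
      filter_upwards [hk'] with G hG
      exact ⟨fun h => absurd h hG, fun h => absurd h hk⟩
  refine ⟨S, fun n c hc T => ?_⟩
  refine le_of_forall_pos_le_add fun ε hε => ?_
  -- The cut of G and the limit cut may disagree outside T₀, but there the weight at n is below ε/2.
  -- The bound 2(c + ε/2) results.
  obtain ⟨T₀, hT₀⟩ := summable_iff_vanishing_norm.1 (hsum n) (ε / 2) (half_pos hε)
  have hev : ∀ᶠ G in (U : Filter (Finset ι)), ∀ k ∈ insert n (T₀ ∪ T), (χ G k ↔ k ∈ S) :=
    (Finset.eventually_all _).2 fun k _ => hSU k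
  obtain ⟨G, hG, hTG⟩ := (hev.and (hU (Filter.eventually_ge_atTop (insert n (T₀ ∪ T))))).exists
  have hTG' : insert n (T₀ ∪ T) ⊆ G := hTG
  have h1 := hχ G n (hTG' (Finset.mem_insert_self _ _))
  have h2 : ∑ k ∈ T, w n k ≤ ∑ k ∈ G, w n k := by
    refine Finset.sum_le_sum_of_subset_of_nonneg (fun k hk => hTG' ?_) fun _ _ _ => hnonneg _ _
    simp [hk]
  set A := G.filter fun k => ¬(χ G k ↔ χ G n)
  have h3 : ∑ k ∈ A, w n k = ∑ k ∈ A ∩ T₀, w n k + ∑ k ∈ A \ T₀, w n k :=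
    (Finset.sum_inter_add_sum_sdiff A T₀ _).symm
  have h4 : ∑ k ∈ A ∩ T₀, w n k ≤ c := by
    refine hc _ fun k hk => ?_
    rw [Finset.mem_inter] at hk
    have h5 := (Finset.mem_filter.1 hk.1).2
    rwa [hG k (by simp [hk.2]), hG n (by simp)] at h5
  have h5 : ∑ k ∈ A \ T₀, w n k < ε / 2 :=
    lt_of_le_of_lt (Real.le_norm_self _) (hT₀ _ Finset.sdiff_disjoint)
  linarith

end Cut

/-! ### From interpolation to lower bounds for B_n(λ_n) -/

theorem neg_log_rho_nonneg {z w : ℂ} (hz : z ∈ disk) (hw : w ∈ disk) :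
    0 ≤ -Real.log (rho z w) :=
  neg_nonneg.2 (Real.log_nonpos (rho_nonneg _ _) (rho_lt_one hz hw).le)

theorem prod_rho_eq_exp {z : ℂ} {F : Finset ι} (hF : ∀ k ∈ F, 0 < rho z (lam k)) :
    ∏ k ∈ F, rho z (lam k) = Real.exp (-∑ k ∈ F, -Real.log (rho z (lam k))) := by
  rw [← Finset.sum_neg_distrib, Real.exp_sum]
  exact Finset.prod_congr rfl fun k hk => by rw [neg_neg, Real.exp_log (hF k hk)]

theorem IsBlaschkeSeq.summable_neg_log_rho (h : IsBlaschkeSeq lam) {z : ℂ} (hz : z ∈ disk) :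
    Summable fun k => -Real.log (rho z (lam k)) := by
  refine ((h.summable_one_sub_rho_sq hz).mul_right 2).of_norm_bounded_eventually ?_
  have hfin := h.finite_rho_le hz (show (1 / 2 : ℝ) < 1 by norm_num)
  filter_upwards [hfin.compl_mem_cofinite] with k hk
  have hk' : 1 / 2 < rho z (lam k) := by simpa using hk
  rw [Real.norm_of_nonneg (neg_log_rho_nonneg hz (h.1 k))]
  refine (neg_log_le (by norm_num : (0 : ℝ) < 1 / 2) hk'.le (rho_lt_one hz (h.1 k)).le).trans_eq ?_
  ring

theorem IsBlaschkeSeq.exists_le_blaschkeDel (h : IsBlaschkeSeq lam)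
    (hinj : Function.Injective lam) (hI : IsInterpolating lam) :
    ∃ H, HarPos H ∧ ∀ n, Real.exp (-H (lam n)) ≤ ‖blaschkeDel lam n (lam n)‖ := by
  classical
  have hpos : ∀ n k, k ≠ n → 0 < rho (lam n) (lam k) := fun n k hk =>
    rho_pos (h.1 n) (h.1 k) fun e => hk (hinj e).symm
  obtain ⟨S, hS⟩ := exists_cut (fun n k => -Real.log (rho (lam n) (lam k)))
    (fun i j => by rw [rho_comm]) (fun i => by simp [rho_self])
    (fun i j => neg_log_rho_nonneg (h.1 i) (h.1 j)) (fun i => h.summable_neg_log_rho (h.1 i))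
  have hone : (fun _ => 1 : ι → ℂ) ∈ traceSpace lam :=
    ⟨fun _ => 1, nevanlinna_of_norm_le_exp (by fun_prop) (harPos_const one_pos) (by simp),
      fun _ => rfl⟩
  -- The constant 1 times the indicator of P is again a trace. Its interpolating function is 1 at
  -- λ_n and 0 at the nodes outside P, so 1 ≤ exp(H(λ_n)) ∏ ρ(λ_n, λ_k). Two such functions, one for
  -- each side of the cut, suffice for all n.
  have hind : ∀ P : ι → Prop, ∃ H, HarPos H ∧ ∀ n, P n → ∀ F : Finset ι, (∀ k ∈ F, ¬ P k) →
      ∑ k ∈ F, -Real.log (rho (lam n) (lam k)) ≤ H (lam n) := by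
    intro P
    obtain ⟨f, hf, hfv⟩ := hI _ hone (fun k => if P k then 1 else 0)
      ⟨1, fun n => by split_ifs <;> simp⟩
    obtain ⟨H, hH, hle⟩ := hf.exists_norm_le_exp
    refine ⟨H, hH, fun n hn F hF => ?_⟩
    have h1 := norm_le_exp_mul_prod_rho hinj h.1 hH hf.1 hle (F := F)
      (fun k hk => by simp [hfv k, hF k hk]) (h.1 n)
    rw [hfv n, prod_rho_eq_exp fun k hk => hpos n k fun e => hF k hk (e ▸ hn), ← Real.exp_add]
      at h1
    simp only [hn, if_true, mul_one, norm_one] at h1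
    have := Real.one_le_exp_iff.1 h1
    linarith
  obtain ⟨H₁, hH₁, h1⟩ := hind (· ∈ S)
  obtain ⟨H₂, hH₂, h2⟩ := hind (· ∉ S)
  refine ⟨fun z => 2 * (H₁ z + H₂ z), (hH₁.add hH₂).const_mul two_pos, fun n => ?_⟩
  refine h.le_norm_blaschkeDel (h.1 n) n fun F hF => ?_
  rw [prod_rho_eq_exp fun k hk => hpos n k fun e => hF (e ▸ hk)]
  refine Real.exp_le_exp.2 (neg_le_neg ?_)
  refine hS n _ (fun T hT => ?_) F
  have p1 := hH₁.pos (h.1 n)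
  have p2 := hH₂.pos (h.1 n)
  by_cases hn : n ∈ S
  · have := h1 n hn T fun k hk => by simpa [hn] using hT k hk
    linarith
  · have := h2 n hn T fun k hk => by simpa [hn] using hT k hk
    linarith

/-! ### Lower bounds for B and its derivative -/

theorem IsBlaschkeSeq.sum_neg_log_rho_le_of_le (h : IsBlaschkeSeq lam)
    (hinj : Function.Injective lam) {n : ι} {x : ℝ}
    (hB : Real.exp (-x) ≤ ‖blaschkeDel lam n (lam n)‖) {F : Finset ι} (hF : n ∉ F) :
    ∑ k ∈ F, -Real.log (rho (lam n) (lam k)) ≤ x := by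
  have h1 := hB.trans (h.norm_blaschkeDel_le (h.1 n) n F hF)
  rw [prod_rho_eq_exp fun k hk => rho_pos (h.1 n) (h.1 k) fun e => hF (hinj e ▸ hk)] at h1
  linarith [Real.exp_le_exp.1 h1]

theorem log_two_le_one : Real.log 2 ≤ 1 := by
  have := Real.log_le_sub_one_of_pos (zero_lt_two (α := ℝ))
  linarith

theorem neg_log_le_add_log_two {x y : ℝ} (hx : 0 < x) (hxy : x ≤ 2 * y) :
    -Real.log y ≤ -Real.log x + Real.log 2 := by
  have h1 := Real.log_le_log hx hxy
  have hy : 0 < y := by linarith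
  rw [Real.log_mul two_ne_zero hy.ne'] at h1
  linarith

/-- As λ_n is nearest, ρ(λ_n, λ_k) ≤ 2ρ(z, λ_k). Far points cost 2K(z). If there is a near point,
then λ_n is near too, and the near points cost H(λ_n) ≤ 3H(z) by Harnack plus log 2 for each of at
most 2K(z) points. -/
theorem IsBlaschkeSeq.exp_le_blaschkeDel_nearest (h : IsBlaschkeSeq lam)
    (hinj : Function.Injective lam) {H : ℂ → ℝ} (hH : HarPos H)
    (hB : ∀ n, Real.exp (-H (lam n)) ≤ ‖blaschkeDel lam n (lam n)‖) {z : ℂ} (hz : z ∈ disk)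
    {n : ι} (hn : ∀ k, rho z (lam n) ≤ rho z (lam k)) :
    Real.exp (-(3 * H z + 4 * blaschkePotential lam z)) ≤ ‖blaschkeDel lam n z‖ := by
  refine h.le_norm_blaschkeDel hz n fun F hF => ?_
  have h2 : ∀ k ∈ F, 0 < rho (lam n) (lam k) := fun k hk =>
    rho_pos (h.1 n) (h.1 k) fun e => hF (hinj e ▸ hk)
  have h3 : ∀ k, rho (lam n) (lam k) ≤ 2 * rho z (lam k) := by
    intro k
    have := rho_triangle (h.1 n) hz (h.1 k)
    rw [rho_comm (lam n) z] at this
    linarith [hn k]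
  rw [prod_rho_eq_exp fun k hk => by linarith [h2 k hk, h3 k]]
  refine Real.exp_le_exp.2 (neg_le_neg ?_)
  rw [← Finset.sum_filter_add_sum_filter_not F (fun k => 1 / 2 ≤ rho z (lam k))]
  have hfar := h.sum_neg_log_rho_le hz (by norm_num : (0 : ℝ) < 1 / 2)
    (F := F.filter fun k => 1 / 2 ≤ rho z (lam k)) fun k hk => (Finset.mem_filter.1 hk).2
  set N := F.filter fun k => ¬ 1 / 2 ≤ rho z (lam k) with hN
  have hN' : ∀ k ∈ N, k ∈ F ∧ rho z (lam k) ≤ 1 / 2 := fun k hk =>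
    ⟨(Finset.mem_filter.1 hk).1, (not_le.1 (Finset.mem_filter.1 hk).2).le⟩
  have hKpos : 0 ≤ blaschkePotential lam z := by
    simpa using h.sum_one_sub_rho_sq_le hz ∅
  have hnear : ∑ k ∈ N, -Real.log (rho z (lam k)) ≤ 3 * H z + 2 * blaschkePotential lam z := by
    rcases N.eq_empty_or_nonempty with he | ⟨j, hj⟩
    · rw [he, Finset.sum_empty]
      linarith [hH.pos hz]
    · have hr : rho z (lam n) ≤ 1 / 2 := (hn j).trans (hN' j hj).2
      have h4 := hH.le_three_mul hz (h.1 n) hr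
      have h5 : ∑ k ∈ N, -Real.log (rho z (lam k))
          ≤ ∑ k ∈ N, (-Real.log (rho (lam n) (lam k)) + Real.log 2) :=
        Finset.sum_le_sum fun k hk => neg_log_le_add_log_two (h2 k (hN' k hk).1) (h3 k)
      rw [Finset.sum_add_distrib, Finset.sum_const, nsmul_eq_mul] at h5
      have h6 := h.sum_neg_log_rho_le_of_le hinj (hB n) (F := N) fun hk => hF (hN' n hk).1
      have h7 := h.card_mul_le hz fun k hk => (hN' k hk).2
      have h8 : (N.card : ℝ) * Real.log 2 ≤ N.card * 1 :=
        mul_le_mul_of_nonneg_left log_two_le_one (Nat.cast_nonneg _)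
      linarith
  linarith

theorem IsBlaschkeSeq.exists_exp_mul_rhoSet_le [Nonempty ι] (h : IsBlaschkeSeq lam)
    (hinj : Function.Injective lam) {H : ℂ → ℝ} (hH : HarPos H)
    (hB : ∀ n, Real.exp (-H (lam n)) ≤ ‖blaschkeDel lam n (lam n)‖) :
    ∃ H, HarPos H ∧ ∀ z ∈ disk, Real.exp (-H z) * rhoSet z lam ≤ ‖blaschke lam z‖ := by
  refine ⟨_, (hH.const_mul three_pos).add (h.harPos_potential.const_mul four_pos),
    fun z hz => ?_⟩
  obtain ⟨n, hn⟩ := h.exists_nearest hz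
  rw [rhoSet_eq hn, h.norm_blaschke_eq_mul hz n, mul_comm]
  exact mul_le_mul_of_nonneg_left (h.exp_le_blaschkeDel_nearest hinj hH hB hz hn) (rho_nonneg _ _)

theorem IsBlaschkeSeq.exists_separation (h : IsBlaschkeSeq lam)
    (hinj : Function.Injective lam) (n : ι) : ∃ d > 0, ∀ k, k ≠ n → d ≤ rho (lam n) (lam k) := by
  by_cases hne : Nonempty {k // k ≠ n}
  · obtain ⟨⟨m, hm⟩, hmin⟩ := (h.subtype (· ≠ n)).exists_nearest (h.1 n)
    exact ⟨_, rho_pos (h.1 n) (h.1 m) fun e => hm (hinj e).symm, fun k hk => hmin ⟨k, hk⟩⟩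
  · exact ⟨1, one_pos, fun k hk => absurd ⟨⟨k, hk⟩⟩ hne⟩

theorem tendsto_rho_self {a : ℂ} (ha : a ∈ disk) :
    Filter.Tendsto (fun z => rho z a) (nhds a) (nhds 0) := by
  have h1 : ContinuousAt (fun z => rho z a) a :=
    ((continuousOn_rho ha).mono Metric.ball_subset_closedBall).continuousAt
      (isOpen_disk.mem_nhds ha)
  have h2 := h1.tendsto
  rwa [rho_self] at h2

/-- Λ is discrete, so close to λ_n the distance to Λ is ρ(z, λ_n). Cancelling it against the factor
b_{λ_n} and letting z → λ_n gives the bound. -/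
theorem IsBlaschkeSeq.exp_le_of_exp_mul_rhoSet_le (h : IsBlaschkeSeq lam)
    (hinj : Function.Injective lam) {H : ℂ → ℝ} (hH : HarPos H)
    (hB : ∀ z ∈ disk, Real.exp (-H z) * rhoSet z lam ≤ ‖blaschke lam z‖) (n : ι) :
    Real.exp (-H (lam n)) ≤ ‖blaschkeDel lam n (lam n)‖ := by
  have : Nonempty ι := ⟨n⟩
  obtain ⟨d, hd, hdk⟩ := h.exists_separation hinj n
  have hn := isOpen_disk.mem_nhds (h.1 n)
  have c1 : ContinuousAt (fun z => Real.exp (-H z)) (lam n) :=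
    ((hH.1.continuousOn.continuousAt hn).neg).rexp
  have c2 : ContinuousAt (fun z => ‖blaschkeDel lam n z‖) (lam n) :=
    (((h.differentiableOn_del n).differentiableAt hn).continuousAt).norm
  refine le_of_tendsto_of_tendsto (c1.continuousWithinAt (s := {lam n}ᶜ))
    (c2.continuousWithinAt (s := {lam n}ᶜ)) ?_
  filter_upwards [self_mem_nhdsWithin, mem_nhdsWithin_of_mem_nhds hn,
    mem_nhdsWithin_of_mem_nhds ((tendsto_rho_self (h.1 n)).eventually_lt_const (half_pos hd))]
    with z hz hzd hzr
  have h1 : ∀ k, rho z (lam n) ≤ rho z (lam k) := by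
    intro k
    by_cases hk : k = n
    · rw [hk]
    · have h2 := hdk k hk
      have h3 := rho_triangle (h.1 n) hzd (h.1 k)
      have h4 : rho z (lam n) < d / 2 := hzr
      rw [rho_comm (lam n) z] at h3
      linarith
  have h5 := hB z hzd
  rw [rhoSet_eq h1, h.norm_blaschke_eq_mul hzd n, mul_comm] at h5
  exact le_of_mul_le_mul_left h5 (rho_pos hzd (h.1 n) hz)

theorem IsBlaschkeSeq.exists_exp_le_add_deriv [Nonempty ι] (h : IsBlaschkeSeq lam)
    (hinj : Function.Injective lam) {H : ℂ → ℝ} (hH : HarPos H)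
    (hB : ∀ n, Real.exp (-H (lam n)) ≤ ‖blaschkeDel lam n (lam n)‖) :
    ∃ H, HarPos H ∧ ∀ z ∈ disk, Real.exp (-H z) ≤
      ‖blaschke lam z‖ + (1 - ‖z‖ ^ 2) * ‖deriv (blaschke lam) z‖ := by
  refine ⟨_, (((hH.const_mul three_pos).add (h.harPos_potential.const_mul four_pos)).const_mul
    two_pos).add (harPos_const (c := 15) (by norm_num)), fun z hz => ?_⟩
  obtain ⟨n, hn⟩ := h.exists_nearest hz
  have h1 := h.exp_le_blaschkeDel_nearest hinj hH hB hz hn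
  set b := ‖blaschkeDel lam n z‖ with hb
  set r := rho z (lam n) with hr
  have hz2 := one_sub_norm_sq_pos hz
  have hb1 : b ≤ 1 := h.norm_blaschkeDel_le_one n hz
  have hr0 : 0 ≤ r := rho_nonneg _ _
  have hb0 : 0 ≤ b := norm_nonneg _
  have h2 : (1 - r ^ 2) * b - 4 * r ≤ (1 - ‖z‖ ^ 2) * ‖deriv (blaschke lam) z‖ := by
    have h3 := norm_deriv_le_four (h.differentiableOn_del n)
      (fun w hw => h.norm_blaschkeDel_le_one n hw) hz
    have h4 := norm_sub_norm_le (deriv (blaschkeFactor (lam n)) z * blaschkeDel lam n z)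
      (-(blaschkeFactor (lam n) z * deriv (blaschkeDel lam n) z))
    rw [sub_neg_eq_add, ← h.deriv_blaschke hz n, norm_neg, norm_mul, norm_mul,
      norm_blaschkeFactor] at h4
    have h5 := mul_le_mul_of_nonneg_left h4 hz2.le
    have h6 := norm_deriv_blaschkeFactor (h.1 n) hz
    have h7 := mul_le_mul_of_nonneg_left h3 hr0
    calc _ ≤ _ := ?_
      _ ≤ _ := h5
    rw [← hr, ← hb, mul_sub, ← mul_assoc, h6]
    linarith
  -- If r ≤ b/16, the derivative term dominates by `h2`; otherwise |B(z)| = rb is already large. The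
  -- square explains the factor 2 in the majorant, and the constant 15 absorbs 1/16 since exp 15 ≥
  -- 16.
  have h8 : b ^ 2 / 16 ≤ ‖blaschke lam z‖ + (1 - ‖z‖ ^ 2) * ‖deriv (blaschke lam) z‖ := by
    rw [h.norm_blaschke_eq_mul hz n]
    rcases le_total r (b / 16) with h9 | h9
    · have := mul_nonneg hr0 hb0
      have e1 : r ^ 2 ≤ 1 / 256 := by nlinarith
      have e2 : r ^ 2 * b ≤ 1 / 256 * b := mul_le_mul_of_nonneg_right e1 hb0
      nlinarith
    · have := mul_nonneg hz2.le (norm_nonneg (deriv (blaschke lam) z))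
      nlinarith
  refine le_trans ?_ h8
  have h9 : Real.exp (-15) ≤ 1 / 16 := by
    rw [Real.exp_neg, one_div]
    refine inv_anti₀ (by norm_num) ?_
    linarith [Real.add_one_le_exp (15 : ℝ)]
  calc _ = Real.exp (-(3 * H z + 4 * blaschkePotential lam z)) ^ 2 * Real.exp (-15) := by
        rw [← Real.exp_nat_mul, ← Real.exp_add]
        congr 1
        push_cast
        ring
    _ ≤ b ^ 2 * (1 / 16) := by gcongr
    _ = _ := by ring

theorem IsBlaschkeSeq.exp_le_of_exp_le_add_deriv (h : IsBlaschkeSeq lam) {H : ℂ → ℝ}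
    (hB : ∀ z ∈ disk, Real.exp (-H z) ≤
      ‖blaschke lam z‖ + (1 - ‖z‖ ^ 2) * ‖deriv (blaschke lam) z‖) (n : ι) :
    Real.exp (-H (lam n)) ≤ ‖blaschkeDel lam n (lam n)‖ := by
  have h1 := hB _ (h.1 n)
  rwa [h.deriv_blaschke_self n, h.norm_blaschke_eq_mul (h.1 n) n, rho_self, zero_mul, zero_add]
    at h1

/-! ### Subharmonic functions and the maximum principle -/

theorem circleAverage_lt_of_le {u : ℂ → ℝ} {c : ℂ} {r m : ℝ} (hr : 0 < r)
    (hi : CircleIntegrable u c r) (hle : ∀ z ∈ Metric.sphere c r, u z ≤ m)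
    (hlt : ∀ z ∈ Metric.sphere c r, c.re < z.re → u z < m) : Real.circleAverage u c r < m := by
  have hs : ∀ θ, circleMap c r θ ∈ Metric.sphere c r := fun θ => circleMap_mem_sphere c hr.le θ
  have hre : ∀ θ : ℝ, (circleMap c r θ).re = c.re + r * Real.cos θ := by
    intro θ
    rw [circleMap, Complex.add_re, Complex.re_ofReal_mul, Complex.exp_ofReal_mul_I_re]
  have hpi := Real.pi_gt_three
  have hi' : IntervalIntegrable (fun θ : ℝ => m - u (circleMap c r θ)) MeasureTheory.volume 0
      (2 * Real.pi) := intervalIntegrable_const.sub hi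
  have hi1 := hi'.mono_set (c := 0) (d := 1) (by
    rw [Set.uIcc_of_le zero_le_one, Set.uIcc_of_le (by positivity)]
    exact Set.Icc_subset_Icc_right (by linarith))
  have hi2 := hi'.mono_set (c := 1) (d := 2 * Real.pi) (by
    rw [Set.uIcc_of_le (by linarith), Set.uIcc_of_le (by positivity)]
    exact Set.Icc_subset_Icc_left zero_le_one)
  -- The arc with angles in (0, 1) lies in the right half of the circle, as 1 < π/2; strictness
  -- there is enough.
  have h1 : 0 < ∫ θ in (0 : ℝ)..1, (m - u (circleMap c r θ)) := by
    refine intervalIntegral.intervalIntegral_pos_of_pos_on hi1 (fun θ hθ => ?_) zero_lt_one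
    refine sub_pos.2 (hlt _ (hs θ) ?_)
    rw [hre]
    have := Real.cos_pos_of_mem_Ioo (x := θ) ⟨by linarith [hθ.1], by linarith [hθ.2]⟩
    nlinarith
  have h2 : 0 ≤ ∫ θ in (1 : ℝ)..(2 * Real.pi), (m - u (circleMap c r θ)) :=
    intervalIntegral.integral_nonneg (by linarith) fun θ _ => sub_nonneg.2 (hle _ (hs θ))
  have h3 := intervalIntegral.integral_add_adjacent_intervals hi1 hi2
  rw [intervalIntegral.integral_sub intervalIntegrable_const hi,
    intervalIntegral.integral_const, smul_eq_mul, sub_zero] at h3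
  rw [Real.circleAverage, smul_eq_mul, inv_mul_lt_iff₀ (by positivity)]
  linarith

/-- The **maximum principle** for subharmonic functions on bounded open sets. -/
theorem SubharmonicOn.le_of_frontier {u : ℂ → ℝ} {Ω : Set ℂ} (hu : SubharmonicOn u Ω)
    (hΩ : IsOpen Ω) (hb : Bornology.IsBounded Ω) {M : ℝ}
    (hf : ∀ ξ ∈ frontier Ω, ∀ t, M < t → ∀ᶠ z in nhdsWithin ξ Ω, u z < t) {z : ℂ} (hz : z ∈ Ω) :
    u z ≤ M := by
  by_contra! hlt
  have husc := upperSemicontinuousOn_iff.1 hu.1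
  -- The boundary condition keeps the level sets above M away from the frontier, so maxima over them
  -- are attained.
  have hcpt : ∀ t, M < t → IsCompact {w ∈ Ω | t ≤ u w} := by
    intro t ht
    refine Metric.isCompact_of_isClosed_isBounded (isClosed_of_closure_subset fun x hx => ?_)
      (hb.subset fun w hw => hw.1)
    have hxc : x ∈ closure Ω := closure_mono (fun w hw => hw.1) hx
    have hcon : ¬ ∀ᶠ w in nhdsWithin x Ω, u w < t := by
      intro hev
      rw [eventually_nhdsWithin_iff] at hev
      obtain ⟨w, hw1, hw2⟩ := mem_closure_iff_nhds.1 hx _ hev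
      exact absurd (hw1 hw2.1) (not_lt.2 hw2.2)
    by_cases hxΩ : x ∈ Ω
    · exact ⟨hxΩ, not_lt.1 fun hlt' => hcon (husc x hxΩ t hlt')⟩
    · refine absurd (hf x ?_ t ht) hcon
      rw [hΩ.frontier_eq]
      exact ⟨hxc, hxΩ⟩
  obtain ⟨p, hp, hpmax⟩ := UpperSemicontinuousOn.exists_isMaxOn
    (show {w ∈ Ω | u z ≤ u w}.Nonempty from ⟨z, hz, le_refl (u z)⟩) (hcpt (u z) hlt) (hu.1.mono fun w hw => hw.1)
  have hmax : ∀ w ∈ Ω, u w ≤ u p := by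
    intro w hw
    rcases le_total (u z) (u w) with h | h
    · exact hpmax ⟨hw, h⟩
    · exact h.trans hp.2
  -- Among the maximum points one with largest real part is chosen: u is strictly smaller on the
  -- right half of any small circle about it, against the sub-mean value property. No connectedness
  -- is needed.
  obtain ⟨c, hc, hcmax⟩ := (hcpt (u p) (hlt.trans_le hp.2)).exists_isMaxOn ⟨p, hp.1, le_rfl⟩
    Complex.continuous_re.continuousOn
  obtain ⟨r, hr, hsub⟩ := Metric.nhds_basis_closedBall.mem_iff.1 (hΩ.mem_nhds hc.1)
  obtain ⟨hi, hmean⟩ := hu.2 c r hr hsub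
  have hsp : ∀ w ∈ Metric.sphere c r, w ∈ Ω := fun w hw =>
    hsub (Metric.sphere_subset_closedBall hw)
  have := circleAverage_lt_of_le (m := u p) hr hi (fun w hw => hmax w (hsp w hw)) fun w hw hre => by
    refine lt_of_not_ge fun hge => ?_
    exact absurd (hcmax (show w ∈ {w ∈ Ω | u p ≤ u w} from ⟨hsp w hw, hge⟩)) (not_le.2 hre)
  linarith [hc.2]

theorem SubharmonicOn.add {u v : ℂ → ℝ} {Ω : Set ℂ} (hu : SubharmonicOn u Ω)
    (hv : SubharmonicOn v Ω) : SubharmonicOn (fun z => u z + v z) Ω := by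
  refine ⟨hu.1.add hv.1, fun c r hr hc => ?_⟩
  obtain ⟨h1, h2⟩ := hu.2 c r hr hc
  obtain ⟨h3, h4⟩ := hv.2 c r hr hc
  refine ⟨h1.add h3, ?_⟩
  rw [Real.circleAverage_fun_add h1 h3]
  exact add_le_add h2 h4

theorem subharmonicOn_of_harmonicOnNhd {u : ℂ → ℝ} {Ω : Set ℂ}
    (hu : InnerProductSpace.HarmonicOnNhd u Ω) : SubharmonicOn u Ω := by
  refine ⟨hu.continuousOn.upperSemicontinuousOn, fun c r hr hc => ⟨?_, ?_⟩⟩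
  · exact (hu.continuousOn.mono (Metric.sphere_subset_closedBall.trans hc)).circleIntegrable hr.le
  · rw [InnerProductSpace.HarmonicOnNhd.circleAverage_eq (hu.mono (by rwa [abs_of_pos hr]))]

/-! ### Green potentials and the perforated domains -/

/-- The Green potential of finitely many points of the disk. -/
noncomputable def greenSum (lam : ι → ℂ) (F : Finset ι) (z : ℂ) : ℝ :=
  ∑ k ∈ F, -Real.log (rho z (lam k))

theorem harmonicAt_greenSum (hlam : ∀ k, lam k ∈ disk) {F : Finset ι} {z : ℂ} (hz : z ∈ disk)
    (hF : ∀ k ∈ F, 0 < rho z (lam k)) :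
    InnerProductSpace.HarmonicAt (greenSum lam F) z := by
  classical
  unfold greenSum
  induction F using Finset.induction_on with
  | empty => simp
  | insert m F hm ih =>
    simp only [Finset.sum_insert hm]
    refine InnerProductSpace.HarmonicAt.add ?_ (ih fun k hk => hF k (Finset.mem_insert_of_mem hk))
    simp only [← norm_blaschkeFactor]
    refine InnerProductSpace.HarmonicAt.neg ?_
    refine AnalyticAt.harmonicAt_log_norm
      ((differentiableOn_blaschkeFactor (hlam m)).analyticAt (isOpen_disk.mem_nhds hz)) ?_
    rw [← norm_pos_iff, norm_blaschkeFactor]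
    exact hF m (Finset.mem_insert_self _ _)

theorem continuousWithinAt_greenSum (hlam : ∀ k, lam k ∈ disk) {F : Finset ι} {z : ℂ}
    (hz : ‖z‖ ≤ 1) (hF : ∀ k ∈ F, 0 < rho z (lam k)) :
    ContinuousWithinAt (greenSum lam F) (Metric.closedBall 0 1) z := by
  unfold greenSum
  refine tendsto_finsetSum _ fun k hk => ?_
  exact (((continuousOn_rho (hlam k)) z (by simpa using hz)).log (hF k hk).ne').neg

theorem greenSum_of_norm_eq_one (hlam : ∀ k, lam k ∈ disk) (F : Finset ι) {z : ℂ}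
    (hz : ‖z‖ = 1) : greenSum lam F z = 0 :=
  Finset.sum_eq_zero fun k _ => by rw [rho_eq_one (hlam k) hz]; simp

theorem greenSum_nonneg (hlam : ∀ k, lam k ∈ disk) (F : Finset ι) {z : ℂ} (hz : z ∈ disk) :
    0 ≤ greenSum lam F z :=
  Finset.sum_nonneg fun k _ => neg_log_rho_nonneg hz (hlam k)

section Domain

variable {H : ℂ → ℝ} {n : ι}

theorem isOpen_hDomain : IsOpen (hDomain lam H n) := isOpen_interior

theorem hDomain_subset_disk : hDomain lam H n ⊆ disk :=
  interior_subset.trans Set.sdiff_subset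

theorem isBounded_hDomain : Bornology.IsBounded (hDomain lam H n) :=
  Metric.isBounded_ball.subset hDomain_subset_disk

theorem le_rho_of_mem_hDomain {z : ℂ} (hz : z ∈ hDomain lam H n) {k : ι} (hk : k ≠ n)
    (hkn : rho (lam k) (lam n) ≤ 1 / 2) : Real.exp (-H (lam k)) ≤ rho z (lam k) := by
  by_contra! hlt
  refine (interior_subset hz).2 (Set.mem_biUnion (x := k) ⟨hk, hkn⟩ ?_)
  exact ⟨hDomain_subset_disk hz, by rwa [rho_comm]⟩

theorem norm_le_one_of_mem_closure {Ω : Set ℂ} (hΩ : Ω ⊆ disk) {z : ℂ} (hz : z ∈ closure Ω) :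
    ‖z‖ ≤ 1 := by
  simpa using closure_minimal (hΩ.trans Metric.ball_subset_closedBall) Metric.isClosed_closedBall hz

theorem le_rho_of_mem_closure {Ω : Set ℂ} (hΩ : Ω ⊆ disk) {a : ℂ} (ha : a ∈ disk) {r : ℝ}
    (hr : ∀ z ∈ Ω, r ≤ rho z a) {z : ℂ} (hz : z ∈ closure Ω) : r ≤ rho z a := by
  have hc := (continuousOn_rho ha).preimage_isClosed_of_isClosed Metric.isClosed_closedBall
    (isClosed_Ici (a := r))
  have hsub : Ω ⊆ Metric.closedBall 0 1 ∩ (fun z => rho z a) ⁻¹' Set.Ici r :=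
    fun w hw => ⟨Metric.ball_subset_closedBall (hΩ hw), hr w hw⟩
  exact (closure_minimal hsub hc hz).2

theorem eventually_lt_rho {a z : ℂ} (ha : a ∈ disk) (hz : z ∈ disk) {r : ℝ} (hr : r < rho z a) :
    ∀ᶠ w in nhds z, r < rho w a := by
  have h1 : ContinuousAt (fun z => rho z a) z :=
    ((continuousOn_rho ha).mono Metric.ball_subset_closedBall).continuousAt
      (isOpen_disk.mem_nhds hz)
  exact h1.eventually_const_lt hr

/-- Only finitely many disks are removed, so they cannot accumulate at a point of the open disk that
lies off all their closures. -/
theorem IsBlaschkeSeq.exists_rho_le_of_mem_frontier (h : IsBlaschkeSeq lam) {z : ℂ}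
    (hz : z ∈ frontier (hDomain lam H n)) (hzd : z ∈ disk) :
    ∃ k, k ≠ n ∧ rho (lam k) (lam n) ≤ 1 / 2 ∧ rho z (lam k) ≤ Real.exp (-H (lam k)) := by
  by_contra! hcon
  rw [isOpen_hDomain.frontier_eq] at hz
  refine hz.2 (mem_interior_iff_mem_nhds.2 ?_)
  have hfin : {k : ι | k ≠ n ∧ rho (lam k) (lam n) ≤ 1 / 2}.Finite := by
    refine (h.finite_rho_le (h.1 n) (show (1 / 2 : ℝ) < 1 by norm_num)).subset fun k hk => ?_
    simpa [rho_comm] using hk.2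
  have hev := (Filter.eventually_all_finite hfin).2 fun k hk =>
    eventually_lt_rho (h.1 k) hzd (hcon k hk.1 hk.2)
  filter_upwards [hev, isOpen_disk.mem_nhds hzd] with w hw hwd
  refine ⟨hwd, fun hmem => ?_⟩
  obtain ⟨k, hk, hwk⟩ := Set.mem_iUnion₂.1 hmem
  have h1 := hw k hk
  have h2 : rho (lam k) w < Real.exp (-H (lam k)) := hwk.2
  rw [rho_comm] at h2
  exact lt_asymm h1 h2

theorem IsBlaschkeSeq.mem_hDomain (h : IsBlaschkeSeq lam)
    (hdis : Pairwise fun j k => Disjoint (hDisk lam H j) (hDisk lam H k)) (n : ι) :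
    lam n ∈ hDomain lam H n := by
  refine mem_interior_iff_mem_nhds.2 ?_
  have h1 := (tendsto_rho_self (h.1 n)).eventually_lt_const (Real.exp_pos (-H (lam n)))
  filter_upwards [h1, isOpen_disk.mem_nhds (h.1 n)] with w hw hwd
  refine ⟨hwd, fun hmem => ?_⟩
  obtain ⟨k, hk, hwk⟩ := Set.mem_iUnion₂.1 hmem
  exact Set.disjoint_left.1 (hdis hk.1) hwk ⟨hwd, by rwa [rho_comm]⟩

theorem IsBlaschkeSeq.exp_le_rho_of_disjoint (h : IsBlaschkeSeq lam)
    (hdis : Pairwise fun j k => Disjoint (hDisk lam H j) (hDisk lam H k)) {j k : ι} (hjk : j ≠ k) :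
    Real.exp (-H (lam j)) ≤ rho (lam j) (lam k) := by
  by_contra! hlt
  have h1 : lam k ∈ hDisk lam H j := ⟨h.1 k, hlt⟩
  have h2 : lam k ∈ hDisk lam H k := ⟨h.1 k, by rw [rho_self]; exact Real.exp_pos _⟩
  exact Set.disjoint_left.1 (hdis hjk) h1 h2

theorem le_one_of_mem_perronFamily {Ω E : Set ℂ} (hΩ : IsOpen Ω) (hb : Bornology.IsBounded Ω)
    {u : ℂ → ℝ} (hu : u ∈ PerronFamily E Ω) {z : ℂ} (hz : z ∈ Ω) : u z ≤ 1 := by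
  refine hu.1.le_of_frontier hΩ hb (fun ξ hξ t ht => hu.2 ξ hξ t (lt_of_le_of_lt ?_ ht)) hz
  exact Set.indicator_le_self' (fun _ _ => zero_le_one) ξ

/-- The maximum principle bounds the Perron values by 1, without which `sSup` would take its default
value 0. Disjointness of the disks places λ_n inside the domain. -/
theorem IsBlaschkeSeq.le_harmonicMeasure (h : IsBlaschkeSeq lam) {u : ℂ → ℝ}
    (hdis : Pairwise fun j k => Disjoint (hDisk lam H j) (hDisk lam H k))
    {E : Set ℂ} (hu : u ∈ PerronFamily E (hDomain lam H n)) :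
    u (lam n) ≤ harmonicMeasure (lam n) E (hDomain lam H n) := by
  refine le_csSup ⟨1, ?_⟩ ⟨u, hu, rfl⟩
  rintro _ ⟨v, hv, rfl⟩
  exact le_one_of_mem_perronFamily isOpen_hDomain isBounded_hDomain hv (h.mem_hDomain hdis n)

end Domain

/-! ### Lower bound for harmonic measure -/

theorem IsBlaschkeSeq.exists_harmonicMeasure_ge (h : IsBlaschkeSeq lam)
    (hinj : Function.Injective lam) {H : ℂ → ℝ} (hH : HarPos H)
    (hB : ∀ n, Real.exp (-H (lam n)) ≤ ‖blaschkeDel lam n (lam n)‖) :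
    ∃ H, HarPos H ∧ (Pairwise fun j k => Disjoint (hDisk lam H j) (hDisk lam H k)) ∧
      ∃ ε : ℝ, 0 < ε ∧ ∀ n,
        ε ≤ harmonicMeasure (lam n) (Metric.sphere 0 1) (hDomain lam H n) := by
  -- The summand 1 halves the radii (1/e ≤ 1/2), so separation makes the disks disjoint. The factor
  -- 6 leaves m = H'(λ_n)/3 ≥ 2H(λ_n) after Harnack's loss of 3.
  set H' : ℂ → ℝ := fun z => 6 * H z + 1 with hH'
  have hHar : HarPos H' := (hH.const_mul (c := 6) (by norm_num)).add (harPos_const one_pos)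
  have hsep : ∀ j k, j ≠ k → Real.exp (-H (lam j)) ≤ rho (lam j) (lam k) := by
    intro j k hjk
    simpa using (hB j).trans (h.norm_blaschkeDel_le (h.1 j) j {k} (by simpa using hjk))
  have hrad : ∀ k, Real.exp (-H' (lam k)) ≤ Real.exp (-H (lam k)) / 2 := by
    intro k
    have h1 : Real.exp (-H' (lam k)) ≤ Real.exp (-H (lam k)) * Real.exp (-1) := by
      rw [← Real.exp_add]
      refine Real.exp_le_exp.2 ?_
      simp only [hH']
      linarith [hH.pos (h.1 k)]
    have h2 : Real.exp (-1) ≤ 1 / 2 := by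
      rw [Real.exp_neg, one_div]
      exact inv_anti₀ two_pos (by linarith [Real.add_one_le_exp (1 : ℝ)])
    nlinarith [Real.exp_pos (-H (lam k))]
  have hdis : Pairwise fun j k => Disjoint (hDisk lam H' j) (hDisk lam H' k) := by
    intro j k hjk
    refine Set.disjoint_left.2 fun w hj hk => ?_
    have h1 : rho (lam j) w < Real.exp (-H' (lam j)) := hj.2
    have h2 : rho (lam k) w < Real.exp (-H' (lam k)) := hk.2
    have h3 := rho_triangle (h.1 j) hj.1 (h.1 k)
    rw [rho_comm w] at h3
    have h4 := hsep k j hjk.symm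
    rw [rho_comm] at h4
    linarith [hsep j k hjk, hrad j, hrad k]
  refine ⟨H', hHar, hdis, 1 / 2, by norm_num, fun n => ?_⟩
  have hfin : {k : ι | k ≠ n ∧ rho (lam k) (lam n) ≤ 1 / 2}.Finite := by
    refine (h.finite_rho_le (h.1 n) (show (1 / 2 : ℝ) < 1 by norm_num)).subset fun k hk => ?_
    simpa [rho_comm] using hk.2
  set F := hfin.toFinset with hF
  have hmemF : ∀ k, k ∈ F ↔ k ≠ n ∧ rho (lam k) (lam n) ≤ 1 / 2 := fun k => by simp [hF]
  set m := H' (lam n) / 3 with hm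
  have hm0 : 0 < m := div_pos (hHar.pos (h.1 n)) three_pos
  have hmk : ∀ k ∈ F, m ≤ H' (lam k) := by
    intro k hk
    have := hHar.le_three_mul (h.1 k) (h.1 n) ((hmemF k).1 hk).2
    linarith
  have hcl : ∀ ξ ∈ closure (hDomain lam H' n), ∀ k ∈ F, 0 < rho ξ (lam k) := fun ξ hξ k hk =>
    lt_of_lt_of_le (Real.exp_pos _) (le_rho_of_mem_closure hDomain_subset_disk (h.1 k)
      (fun z hz => le_rho_of_mem_hDomain hz ((hmemF k).1 hk).1 ((hmemF k).1 hk).2) hξ)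
  -- This harmonic function is 1 on the unit circle and at most 0 on the rest of the frontier, where
  -- some term of the potential is at least m. At λ_n the potential is at most H(λ_n) ≤ m/2.
  set u : ℂ → ℝ := fun z => 1 + (-m⁻¹) * greenSum lam F z with hu
  have hucont : ∀ ξ ∈ closure (hDomain lam H' n),
      ContinuousWithinAt u (hDomain lam H' n) ξ := fun ξ hξ =>
    (((continuousWithinAt_greenSum h.1 (norm_le_one_of_mem_closure hDomain_subset_disk hξ)
      (hcl ξ hξ)).mono (hDomain_subset_disk.trans Metric.ball_subset_closedBall)).const_mul
        _).const_add 1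
  have hmem : u ∈ PerronFamily (Metric.sphere 0 1) (hDomain lam H' n) := by
    refine ⟨subharmonicOn_of_harmonicOnNhd ?_, fun ξ hξ t ht => ?_⟩
    · intro z hz
      exact (InnerProductSpace.harmonicAt_const (1 : ℝ)).add
        ((harmonicAt_greenSum h.1 (hDomain_subset_disk hz)
          (hcl z (subset_closure hz))).const_smul (c := -m⁻¹))
    · have hξc := frontier_subset_closure hξ
      refine (hucont ξ hξc).eventually_lt_const (lt_of_le_of_lt ?_ ht)
      by_cases hs : ‖ξ‖ = 1
      · rw [Set.indicator_of_mem (by simpa using hs), hu]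
        simp [greenSum_of_norm_eq_one h.1 F hs]
      · have hξd : ξ ∈ disk := mem_disk.2
          (lt_of_le_of_ne (norm_le_one_of_mem_closure hDomain_subset_disk hξc) hs)
        rw [Set.indicator_of_notMem (by simpa using hs)]
        obtain ⟨k, hk1, hk2, hk3⟩ := h.exists_rho_le_of_mem_frontier hξ hξd
        have hkF := (hmemF k).2 ⟨hk1, hk2⟩
        have h1 : -Real.log (rho ξ (lam k)) ≤ greenSum lam F ξ :=
          Finset.single_le_sum (f := fun k => -Real.log (rho ξ (lam k)))
            (fun j _ => neg_log_rho_nonneg hξd (h.1 j)) hkF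
        have h2 := (Real.log_le_iff_le_exp (hcl ξ hξc k hkF)).2 hk3
        have h3 : m ≤ greenSum lam F ξ := by linarith [hmk k hkF]
        have h4 : 1 ≤ m⁻¹ * greenSum lam F ξ := by
          rw [inv_mul_eq_div]
          exact (one_le_div hm0).2 h3
        simp only [hu]
        linarith
  refine le_trans ?_ (h.le_harmonicMeasure hdis hmem)
  have h1 : greenSum lam F (lam n) ≤ H (lam n) :=
    h.sum_neg_log_rho_le_of_le hinj (hB n) fun hn => ((hmemF n).1 hn).1 rfl
  have h2 : m⁻¹ * greenSum lam F (lam n) ≤ 1 / 2 := by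
    rw [inv_mul_eq_div, div_le_iff₀ hm0]
    simp only [hm, hH']
    linarith
  simp only [hu]
  linarith

/-! ### From harmonic measure back to lower bounds for B_n(λ_n) -/

section Converse

variable {H : ℂ → ℝ} {n : ι}

/-- Off the disks of radius `exp (-H (lam k)) / 2`, the Green potential is bounded by its bound on
the circles that bound these disks. -/
theorem IsBlaschkeSeq.greenSum_le_of_forall (h : IsBlaschkeSeq lam)
    {A : Finset ι} {M : ℝ} (hM : 0 ≤ M)
    (hA : ∀ ξ ∈ disk, (∀ k ∈ A, Real.exp (-H (lam k)) / 2 ≤ rho ξ (lam k)) →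
      ∀ j ∈ A, rho ξ (lam j) ≤ Real.exp (-H (lam j)) / 2 → greenSum lam A ξ ≤ M)
    {z : ℂ} (hz : z ∈ disk) (hzA : ∀ k ∈ A, Real.exp (-H (lam k)) / 2 < rho z (lam k)) :
    greenSum lam A z ≤ M := by
  set Ω : Set ℂ := {z ∈ disk | ∀ k ∈ A, Real.exp (-H (lam k)) / 2 < rho z (lam k)} with hΩ
  have hnhd : ∀ w ∈ disk, (∀ k ∈ A, Real.exp (-H (lam k)) / 2 < rho w (lam k)) → Ω ∈ nhds w := by
    intro w hwd hw
    filter_upwards [isOpen_disk.mem_nhds hwd, (Finset.eventually_all A).2 fun k hk =>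
      eventually_lt_rho (h.1 k) hwd (hw k hk)] with v hv1 hv2 using ⟨hv1, hv2⟩
  have hopen : IsOpen Ω := isOpen_iff_mem_nhds.2 fun w hw => hnhd w hw.1 hw.2
  have hsub : Ω ⊆ disk := fun w hw => hw.1
  have hcl : ∀ ξ ∈ closure Ω, ∀ k ∈ A, Real.exp (-H (lam k)) / 2 ≤ rho ξ (lam k) :=
    fun ξ hξ k hk => le_rho_of_mem_closure hsub (h.1 k) (fun w hw => (hw.2 k hk).le) hξ
  have hpos : ∀ ξ ∈ closure Ω, ∀ k ∈ A, 0 < rho ξ (lam k) := fun ξ hξ k hk =>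
    lt_of_lt_of_le (half_pos (Real.exp_pos _)) (hcl ξ hξ k hk)
  refine (subharmonicOn_of_harmonicOnNhd fun w hw => harmonicAt_greenSum h.1 (hsub hw)
    (hpos w (subset_closure hw))).le_of_frontier hopen (Metric.isBounded_ball.subset hsub)
    (fun ξ hξ t ht => ?_) (show z ∈ Ω from ⟨hz, hzA⟩)
  have hξc := frontier_subset_closure hξ
  have hξ1 := norm_le_one_of_mem_closure hsub hξc
  refine ((continuousWithinAt_greenSum h.1 hξ1 (hpos ξ hξc)).mono
    (hsub.trans Metric.ball_subset_closedBall)).eventually_lt_const (lt_of_le_of_lt ?_ ht)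
  by_cases hs : ‖ξ‖ = 1
  · rwa [greenSum_of_norm_eq_one h.1 A hs]
  · have hξd : ξ ∈ disk := mem_disk.2 (lt_of_le_of_ne hξ1 hs)
    rw [hopen.frontier_eq] at hξ
    have hex : ∃ j ∈ A, rho ξ (lam j) ≤ Real.exp (-H (lam j)) / 2 := by
      by_contra! hcon
      exact hξ.2 (mem_of_mem_nhds (hnhd ξ hξd hcon))
    obtain ⟨j, hj, hjr⟩ := hex
    exact hA ξ hξd (hcl ξ hξc) j hj hjr

/-- Adding potential/M to a member of the Perron family keeps its boundary values at most 1: the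
potential vanishes on the unit circle and is at most M at the other frontier points. The maximum
principle at λ_n concludes. -/
theorem IsBlaschkeSeq.harmonicMeasure_le (h : IsBlaschkeSeq lam)
    (hdis : Pairwise fun j k => Disjoint (hDisk lam H j) (hDisk lam H k))
    {A : Finset ι} (hAn : ∀ k ∈ A, k ≠ n ∧ rho (lam k) (lam n) ≤ 1 / 2) {M : ℝ} (hM : 0 < M)
    (hA : ∀ ξ ∈ disk, (∀ k ∈ A, Real.exp (-H (lam k)) / 2 ≤ rho ξ (lam k)) →
      ∀ j ∈ A, rho ξ (lam j) ≤ Real.exp (-H (lam j)) / 2 → greenSum lam A ξ ≤ M) :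
    harmonicMeasure (lam n) (Metric.sphere 0 1) (hDomain lam H n)
      ≤ 1 - greenSum lam A (lam n) / M := by
  have hcl : ∀ ξ ∈ closure (hDomain lam H n), ∀ k ∈ A, Real.exp (-H (lam k)) ≤ rho ξ (lam k) :=
    fun ξ hξ k hk => le_rho_of_mem_closure hDomain_subset_disk (h.1 k)
      (fun z hz => le_rho_of_mem_hDomain hz (hAn k hk).1 (hAn k hk).2) hξ
  have hpos : ∀ ξ ∈ closure (hDomain lam H n), ∀ k ∈ A, 0 < rho ξ (lam k) := fun ξ hξ k hk =>
    lt_of_lt_of_le (Real.exp_pos _) (hcl ξ hξ k hk)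
  have hle : ∀ ξ ∈ closure (hDomain lam H n), ξ ∈ disk → greenSum lam A ξ ≤ M :=
    fun ξ hξ hξd => h.greenSum_le_of_forall hM.le hA hξd fun k hk =>
      lt_of_lt_of_le (half_lt_self (Real.exp_pos _)) (hcl ξ hξ k hk)
  have hmem := h.mem_hDomain hdis n
  -- The second goal, nonnegativity of the bound, covers the value 0 of `sSup` on the empty set.
  refine Real.sSup_le ?_ ?_
  · rintro _ ⟨u, hu, rfl⟩
    have hsub : SubharmonicOn (fun z => u z + M⁻¹ * greenSum lam A z) (hDomain lam H n) :=
      hu.1.add (subharmonicOn_of_harmonicOnNhd fun z hz =>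
        (harmonicAt_greenSum h.1 (hDomain_subset_disk hz)
          (hpos z (subset_closure hz))).const_smul (c := M⁻¹))
    have key := hsub.le_of_frontier isOpen_hDomain isBounded_hDomain (M := 1)
      (fun ξ hξ t ht => ?_) hmem
    · simp only [inv_mul_eq_div] at key
      show u (lam n) ≤ _
      linarith
    · have hξc := frontier_subset_closure hξ
      have hξ1 := norm_le_one_of_mem_closure hDomain_subset_disk hξc
      have hc := ((continuousWithinAt_greenSum h.1 hξ1 (hpos ξ hξc)).mono
        ((hDomain_subset_disk (lam := lam) (H := H) (n := n)).trans Metric.ball_subset_closedBall)).const_mul M⁻¹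
      have hsum : (Metric.sphere (0 : ℂ) 1).indicator (fun _ => (1 : ℝ)) ξ
          + M⁻¹ * greenSum lam A ξ ≤ 1 := by
        by_cases hs : ‖ξ‖ = 1
        · rw [Set.indicator_of_mem (by simpa using hs), greenSum_of_norm_eq_one h.1 A hs]
          simp
        · have hξd : ξ ∈ disk := mem_disk.2 (lt_of_le_of_ne hξ1 hs)
          rw [Set.indicator_of_notMem (by simpa using hs), zero_add, inv_mul_eq_div]
          exact div_le_one_of_le₀ (hle ξ hξc hξd) hM.le
      filter_upwards [hu.2 ξ hξ _ (lt_add_of_pos_right _ (half_pos (sub_pos.2 ht))),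
        hc.eventually_lt_const (lt_add_of_pos_right _ (half_pos (sub_pos.2 ht)))] with w h1 h2
      linarith
  · exact sub_nonneg.2 (div_le_one_of_le₀ (hle _ (subset_closure hmem) (h.1 n)) hM.le)

/-- A self-improving estimate. At the worst index m of F, the potential near the other points is
controlled by the same ratio S at those points, with a Harnack loss 1 + ε/2. Harmonic measure at
least ε gains a factor 1 - ε, which beats the loss. Finiteness of F makes S finite beforehand, and
the final bound does not depend on F. -/
theorem IsBlaschkeSeq.greenSum_erase_le [DecidableEq ι] (h : IsBlaschkeSeq lam)
    (hinj : Function.Injective lam) (hH : HarPos H)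
    (hdis : Pairwise fun j k => Disjoint (hDisk lam H j) (hDisk lam H k))
    {ε : ℝ} (hε : 0 < ε)
    (hω : ∀ n, ε ≤ harmonicMeasure (lam n) (Metric.sphere 0 1) (hDomain lam H n))
    (F : Finset ι) (hn : n ∈ F) :
    greenSum lam (F.erase n) (lam n)
      ≤ (6 + 16 / ε) / ε * (H (lam n) + blaschkePotential lam (lam n)) := by
  have : Nonempty ι := ⟨n⟩
  have hK := h.harPos_potential
  set G : ℂ → ℝ := fun z => H z + blaschkePotential lam z with hG
  have hGpos : HarPos G := hH.add hK
  obtain ⟨m, hm, hmax⟩ := F.exists_max_image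
    (fun j => greenSum lam (F.erase j) (lam j) / G (lam j)) ⟨n, hn⟩
  set S := greenSum lam (F.erase m) (lam m) / G (lam m) with hS
  have hGm := hGpos.pos (h.1 m)
  have hS0 : 0 ≤ S := div_nonneg (greenSum_nonneg h.1 _ (h.1 m)) hGm.le
  have hφ : ∀ j ∈ F, greenSum lam (F.erase j) (lam j) ≤ S * G (lam j) := fun j hj =>
    (div_le_iff₀ (hGpos.pos (h.1 j))).1 (hmax j hj)
  have hε1 : ε ≤ 1 := by
    refine (hω m).trans ?_
    have := h.harmonicMeasure_le hdis (n := m) (A := ∅) (by simp) one_pos (by simp)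
    simpa [greenSum] using this
  -- Within distance ε/8 the Harnack factor (1 + ε/8)/(1 - ε/8) is at most 1 + ε/2, because ε ≤ 1.
  have hδ : 0 < ε / 8 := by positivity
  set A := (F.erase m).filter fun k => rho (lam m) (lam k) ≤ ε / 8 with hAdef
  have hAmem : ∀ k ∈ A, k ∈ F ∧ k ≠ m ∧ rho (lam m) (lam k) ≤ ε / 8 := fun k hk =>
    ⟨Finset.mem_of_mem_erase (Finset.mem_filter.1 hk).1,
      Finset.ne_of_mem_erase (Finset.mem_filter.1 hk).1, (Finset.mem_filter.1 hk).2⟩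
  set M := (1 + ε / 2) * (1 + S) * G (lam m) + 2 * G (lam m) with hM
  have hM0 : 0 < M := by positivity
  have hbound : ∀ ξ ∈ disk, (∀ k ∈ A, Real.exp (-H (lam k)) / 2 ≤ rho ξ (lam k)) →
      ∀ j ∈ A, rho ξ (lam j) ≤ Real.exp (-H (lam j)) / 2 → greenSum lam A ξ ≤ M := by
    intro ξ hξ hξA j hj hjr
    have hj' := hAmem j hj
    have e1 : -Real.log (rho ξ (lam j)) ≤ H (lam j) + Real.log 2 := by
      have := Real.log_le_log (half_pos (Real.exp_pos _)) (hξA j hj)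
      rw [Real.log_div (Real.exp_pos _).ne' two_ne_zero, Real.log_exp] at this
      linarith
    -- Here the halved radius is used: ρ(ξ, λ_j) ≤ exp(-H(λ_j))/2 ≤ ρ(λ_j, λ_k)/2, so ρ(λ_j, λ_k) ≤
    -- 2ρ(ξ, λ_k), at a cost of log 2 per point.
    have e2 : ∑ k ∈ A.erase j, -Real.log (rho ξ (lam k))
        ≤ ∑ k ∈ A.erase j, (-Real.log (rho (lam j) (lam k)) + Real.log 2) := by
      refine Finset.sum_le_sum fun k hk => ?_
      have hkj := Finset.ne_of_mem_erase hk
      refine neg_log_le_add_log_two (rho_pos (h.1 j) (h.1 k) fun e => hkj (hinj e).symm) ?_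
      have h1 := h.exp_le_rho_of_disjoint hdis hkj.symm
      have h2 := rho_triangle (h.1 j) hξ (h.1 k)
      rw [rho_comm (lam j) ξ] at h2
      linarith
    rw [Finset.sum_add_distrib, Finset.sum_const, nsmul_eq_mul] at e2
    have e3 : ∑ k ∈ A.erase j, -Real.log (rho (lam j) (lam k))
        ≤ greenSum lam (F.erase j) (lam j) := by
      refine Finset.sum_le_sum_of_subset_of_nonneg (fun k hk => ?_)
        fun k _ _ => neg_log_rho_nonneg (h.1 j) (h.1 k)
      rw [Finset.mem_erase] at hk ⊢
      exact ⟨hk.1, (hAmem k hk.2).1⟩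
    have e4 := hφ j hj'.1
    have e5 : (A.card : ℝ) ≤ 2 * blaschkePotential lam (lam m) :=
      h.card_mul_le (h.1 m) fun k hk => by linarith [(hAmem k hk).2.2]
    have e6 : (A.card : ℝ) = (A.erase j).card + 1 := by
      rw [← Finset.card_erase_add_one hj]; push_cast; rfl
    have e7 : ((A.erase j).card + 1 : ℝ) * Real.log 2 ≤ ((A.erase j).card + 1 : ℝ) * 1 :=
      mul_le_mul_of_nonneg_left log_two_le_one (by positivity)
    have e8 : greenSum lam A ξ ≤ (1 + S) * G (lam j) + 2 * blaschkePotential lam (lam m) := by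
      rw [greenSum, ← Finset.add_sum_erase A _ hj]
      have : H (lam j) ≤ G (lam j) := le_add_of_nonneg_right (hK.pos (h.1 j)).le
      linarith
    have e9 : G (lam j) ≤ (1 + ε / 2) * G (lam m) := by
      have h1 := hGpos.harnack (h.1 m) (h.1 j)
      have h2 := hj'.2.2
      have h3 := hGpos.pos (h.1 j)
      have h4 : G (lam j) * (1 - ε / 8) ≤ (1 + ε / 8) * G (lam m) :=
        (mul_le_mul_of_nonneg_left (by linarith) h3.le).trans
          (h1.trans (mul_le_mul_of_nonneg_right (by linarith) hGm.le))
      have h5 : 1 + ε / 8 ≤ (1 + ε / 2) * (1 - ε / 8) := by nlinarith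
      have h6 := h4.trans (mul_le_mul_of_nonneg_right h5 hGm.le)
      have h7 : 0 < 1 - ε / 8 := by linarith
      refine le_of_mul_le_mul_right ?_ h7
      linarith
    have e10 : (1 + S) * G (lam j) ≤ (1 + S) * ((1 + ε / 2) * G (lam m)) :=
      mul_le_mul_of_nonneg_left e9 (by linarith)
    have e11 : blaschkePotential lam (lam m) ≤ G (lam m) :=
      le_add_of_nonneg_left (hH.pos (h.1 m)).le
    rw [hM]
    linarith
  have hmeas := (hω m).trans (h.harmonicMeasure_le hdis (n := m) (A := A)
    (fun k hk => ⟨(hAmem k hk).2.1, by rw [rho_comm]; linarith [(hAmem k hk).2.2]⟩) hM0 hbound)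
  have hv : greenSum lam A (lam m) ≤ (1 - ε) * M := by
    rw [← div_le_iff₀ hM0]
    linarith
  have hfar := h.sum_neg_log_rho_le (h.1 m) hδ
    (F := (F.erase m).filter fun k => ¬ rho (lam m) (lam k) ≤ ε / 8)
    fun k hk => (not_le.1 (Finset.mem_filter.1 hk).2).le
  have hsplit : greenSum lam (F.erase m) (lam m)
      ≤ (1 - ε) * M + blaschkePotential lam (lam m) / (ε / 8) := by
    rw [greenSum, ← Finset.sum_filter_add_sum_filter_not (F.erase m)
      (fun k => rho (lam m) (lam k) ≤ ε / 8)]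
    exact add_le_add hv hfar
  have hSle : S ≤ (1 - ε) * ((1 + ε / 2) * (1 + S) + 2) + 8 / ε := by
    rw [hS, div_le_iff₀ hGm]
    refine hsplit.trans ?_
    have e11 : blaschkePotential lam (lam m) ≤ G (lam m) :=
      le_add_of_nonneg_left (hH.pos (h.1 m)).le
    have e12 : blaschkePotential lam (lam m) / (ε / 8) ≤ 8 / ε * G (lam m) := by
      rw [div_div_eq_mul_div, div_mul_eq_mul_div, mul_comm]
      gcongr
    rw [hM]
    linarith
  -- Since (1 - ε)(1 + ε/2) ≤ 1 - ε/2, the inequality becomes (ε/2)S ≤ 3 + 8/ε.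
  have hSfin : S ≤ (6 + 16 / ε) / ε := by
    rw [le_div_iff₀ hε]
    have h8 : 16 / ε = 2 * (8 / ε) := by ring
    rw [h8]
    have : (1 - ε) * (1 + ε / 2) ≤ 1 - ε / 2 := by nlinarith
    have h9 := mul_le_mul_of_nonneg_right this (by linarith : 0 ≤ 1 + S)
    nlinarith
  exact (hφ n hn).trans (mul_le_mul_of_nonneg_right hSfin (hGpos.pos (h.1 n)).le)

theorem IsBlaschkeSeq.exists_le_blaschkeDel_of_harmonicMeasure [Nonempty ι] (h : IsBlaschkeSeq lam)
    (hinj : Function.Injective lam) (hH : HarPos H)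
    (hdis : Pairwise fun j k => Disjoint (hDisk lam H j) (hDisk lam H k))
    {ε : ℝ} (hε : 0 < ε)
    (hω : ∀ n, ε ≤ harmonicMeasure (lam n) (Metric.sphere 0 1) (hDomain lam H n)) :
    ∃ H, HarPos H ∧ ∀ n, Real.exp (-H (lam n)) ≤ ‖blaschkeDel lam n (lam n)‖ := by
  classical
  refine ⟨_, (hH.add h.harPos_potential).const_mul (c := (6 + 16 / ε) / ε) (by positivity),
    fun n => h.le_norm_blaschkeDel (h.1 n) n fun F hF => ?_⟩
  rw [prod_rho_eq_exp fun k hk => rho_pos (h.1 n) (h.1 k) fun e => hF (hinj e ▸ hk)]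
  refine Real.exp_le_exp.2 (neg_le_neg ?_)
  have := h.greenSum_erase_le hinj hH hdis hε hω (insert n F) (Finset.mem_insert_self n F)
  rwa [Finset.erase_insert hF] at this

end Converse

end NevInt

theorem theorem1p2 {ι : Type*} [Countable ι] [Nonempty ι] (lam : ι → ℂ)
    (hlam : NevInt.IsBlaschkeSeq lam) (hinj : Function.Injective lam) :
    (∀ n, (1 - ‖lam n‖ ^ 2) * ‖deriv (NevInt.blaschke lam) (lam n)‖
        = ‖NevInt.blaschkeDel lam n (lam n)‖) ∧
    List.TFAE [
      NevInt.IsInterpolating lam,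
      ∃ H, NevInt.HarPos H ∧
        ∀ n, Real.exp (-H (lam n)) ≤ ‖NevInt.blaschkeDel lam n (lam n)‖,
      ∃ H, NevInt.HarPos H ∧
        ∀ z ∈ NevInt.disk,
          Real.exp (-H z) * NevInt.rhoSet z lam ≤ ‖NevInt.blaschke lam z‖,
      ∃ H, NevInt.HarPos H ∧
        ∀ z ∈ NevInt.disk,
          Real.exp (-H z) ≤
            ‖NevInt.blaschke lam z‖ + (1 - ‖z‖ ^ 2) * ‖deriv (NevInt.blaschke lam) z‖,
      ∃ H, NevInt.HarPos H ∧
        Pairwise (fun j k => Disjoint (NevInt.hDisk lam H j) (NevInt.hDisk lam H k)) ∧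
        ∃ ε : ℝ, 0 < ε ∧ ∀ n,
          ε ≤ NevInt.harmonicMeasure (lam n) (Metric.sphere (0 : ℂ) 1) (NevInt.hDomain lam H n)] := by
  refine ⟨hlam.deriv_blaschke_self, ?_⟩
  tfae_have 1 → 2 := hlam.exists_le_blaschkeDel hinj
  tfae_have 2 → 1 := fun ⟨_, hH, hB⟩ => hlam.isInterpolating hH hB
  tfae_have 2 → 3 := fun ⟨_, hH, hB⟩ => hlam.exists_exp_mul_rhoSet_le hinj hH hB
  tfae_have 3 → 2 := fun ⟨H, hH, hB⟩ => ⟨H, hH, hlam.exp_le_of_exp_mul_rhoSet_le hinj hH hB⟩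
  tfae_have 2 → 4 := fun ⟨_, hH, hB⟩ => hlam.exists_exp_le_add_deriv hinj hH hB
  tfae_have 4 → 2 := fun ⟨H, hH, hB⟩ => ⟨H, hH, hlam.exp_le_of_exp_le_add_deriv hB⟩
  tfae_have 2 → 5 := fun ⟨_, hH, hB⟩ => hlam.exists_harmonicMeasure_ge hinj hH hB
  tfae_have 5 → 2 := fun ⟨_, hH, hdis, _, hε, hω⟩ =>
    hlam.exists_le_blaschkeDel_of_harmonicMeasure hinj hH hdis hε hω
  tfae_finish
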